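/- **Setting.** Let $d,K,T,B_1,B_2\ge 1$ be integers, $\delta>0$, $L\ge 0$. Let $z$ be a random data point with law $\mathcal D$, and let $f(x,z)$, $x\in\mathbb R^d$, be a real function that is measurable and integrable in $z\sim\mathcal D$ for every $x$ and, for every $z$, differentiable and $L$-Lipschitz in $x$ (Euclidean norm). Put $F(x)=\mathbb E_z[f(x,z)]$ and $\hat F_\delta(x)=\mathbb E_v[F(x+\delta v)]$ with $v$ uniform on the unit ball. For a batch $z_{1:b}$ draw i.i.d. directions $u_{ij}$ ($i\le b$, $j\le d$), uniform on the unit sphere, and set $$\mathrm{Grad}(x,z_{1:b})=\frac1b\sum_{i=1}^b\frac1d\sum_{j=1}^d\frac{d}{2\delta}\bigl(f(x+\delta u_{ij},z_i)-f(x-\delta u_{ij},z_i)\bigr)u_{ij},$$ $$\mathrm{Diff}(x,y,z_{1:b})=\frac1b\sum_{i=1}^b\frac1d\sum_{j=1}^d\frac{d}{\delta}\bigl(f(x+\delta u_{ij},z_i)-f(y+\delta u_{ij},z_i)\bigr)u_{ij}.$$ **Algorithm.** A data set of $K(B_1+B_2(T-1))$ i.i.d. points with law $\mathcal D$ is partitioned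 into batches $Z_t^k$ ($k\le K$, $t\le T$), of size $B_1$ if $t=1$ and $B_2$ if $t\ge2$. Let $\mathcal A$ be an online linear optimization algorithm (possibly randomized, restarted in every epoch $k$ with a fresh seed) whose decisions all have norm at most $D=\delta/T$; its decision $\Delta_t^k$ in round $t$ is a measurable function of its seed and of $\tilde g_1^k,\dots,\tilde g_{t-1}^k$. Start from a given $x_1^1\in\mathbb R^d$. In epoch $k$ and round $t$, set $$w_t^k=x_t^k+s_t^k\Delta_t^k,\qquad x_{t+1}^k=x_t^k+\Delta_t^k,\qquad s_t^k\sim\mathrm{Uniform}[0,1],$$ $$g_1^k=\mathrm{Grad}(w_1^k,Z_1^k),\qquad g_t^k=g_{t-1}^k+\mathrm{Diff}(w_t^k,w_{t-1}^k,Z_t^k)\ (t\ge2),\qquad \tilde g_t^k=g_t^k+\mathrm{Tree}^k(t),$$ with fresh directions in every query, and $x_1^{k+1}=x_{T+1}^k$. Here $\mathrm{Tree}^k(t)=\sum_{(a,b)\in\mathrm{Node}(t)}\xi_b^k$ with $\xi_b^k\sim N(0,\sigma_b^2I)$ for arbitrary real $\sigma_1,\dots,\sigma_T$, and $\mathrm{Node}(t)$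 is the greedy decomposition of $\{1,\dots,t\}$ into consecutive intervals $[a,b]$ whose lengths are distinct powers of two in decreasing order. All data points, directions, weights $s_t^k$, noises $\xi_b^k$ and seeds are mutually independent. **Lemma.** $\hat F_\delta$ is differentiable, and for all $1\le k\le K$ and $1\le t\le T$ the following expectation exists and satisfies $$\mathbb E\bigl\|\nabla\hat F_\delta(w_t^k)-g_t^k\bigr\|^2\le\frac{16dL^2}{B_1}+\frac{64dL^2}{B_2T}.$$ -/

import Mathlib

open MeasureTheory ProbabilityTheory

noncomputable section

namespace O2NC

/-- The space `ℝ^d` with the Euclidean norm. -/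
abbrev Vec (d : ℕ) : Type := EuclideanSpace ℝ (Fin d)

/-! ### Uniform distributions and uniform smoothing -/

/-- The uniform distribution on the (closed) unit ball of `ℝ^d`. -/
def uniformBall (d : ℕ) : Measure (Vec d) :=
  cond volume (Metric.closedBall (0 : Vec d) 1)

/-- The uniform distribution on the unit sphere of `ℝ^d` (the normalized surface measure), as a
measure on `ℝ^d`. -/
def uniformSphere (d : ℕ) : Measure (Vec d) :=
  (cond (volume : Measure (Vec d)).toSphere Set.univ).map
    (fun u : Metric.sphere (0 : Vec d) 1 => (u : Vec d))

/-- The uniform distribution on `[0,1]`. -/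
def uniformUnitInterval : Measure ℝ := volume.restrict (Set.Icc 0 1)

/-- The uniform smoothing `ĥ_δ(x) = E_v[h(x + δ v)]`, `v` uniform on the unit ball. -/
def smoothing {d : ℕ} (δ : ℝ) (h : Vec d → ℝ) (x : Vec d) : ℝ :=
  ∫ v, h (x + δ • v) ∂(uniformBall d)

/-- The objective `F(x) = E_z[f(x,z)]`. -/
def objective {d : ℕ} {𝒵 : Type*} [MeasurableSpace 𝒵] (𝒟 : Measure 𝒵)
    (f : Vec d → 𝒵 → ℝ) (x : Vec d) : ℝ :=
  ∫ z, f x z ∂𝒟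

/-! ### The two zeroth-order estimators

Each data point `z i` of the batch comes with its own `d` directions `u i 1, …, u i d`. -/

/-- The gradient estimator on a batch of size `b`. -/
def gradEst {d : ℕ} {𝒵 : Type*} (f : Vec d → 𝒵 → ℝ) (δ : ℝ) {b : ℕ} (x : Vec d)
    (z : Fin b → 𝒵) (u : Fin b → Fin d → Vec d) : Vec d :=
  (1 / (b : ℝ)) • ∑ i, (1 / (d : ℝ)) • ∑ j,
    ((d : ℝ) / (2 * δ) * (f (x + δ • u i j) (z i) - f (x - δ • u i j) (z i))) • u i j

/-- The estimator of the gradient difference between `x` and `y` on a batch of size `b`. -/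
def diffEst {d : ℕ} {𝒵 : Type*} (f : Vec d → 𝒵 → ℝ) (δ : ℝ) {b : ℕ} (x y : Vec d)
    (z : Fin b → 𝒵) (u : Fin b → Fin d → Vec d) : Vec d :=
  (1 / (b : ℝ)) • ∑ i, (1 / (d : ℝ)) • ∑ j,
    ((d : ℝ) / δ * (f (x + δ • u i j) (z i) - f (y + δ • u i j) (z i))) • u i j

/-! ### The tree mechanism -/

/-- One pass (index `i`) of the loop in `node`; `m` is `⌈log₂ t⌉` and the state is `(k, S)`. -/
def nodeStep (t m : ℕ) (st : ℕ × Finset (ℕ × ℕ)) (i : ℕ) : ℕ × Finset (ℕ × ℕ) :=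
  if st.1 < t ∧ st.1 + 2 ^ (m - i) ≤ t then
    (st.1 + 2 ^ (m - i), insert (st.1 + 1, st.1 + 2 ^ (m - i)) st.2)
  else st

/-- The set `Node(t)` of dyadic intervals `(a, b)` that decompose `{1, …, t}`. -/
def node (t : ℕ) : Finset (ℕ × ℕ) :=
  ((List.range (Nat.clog 2 t + 1)).foldl (nodeStep t (Nat.clog 2 t)) (0, ∅)).2

/-- `Tree(t) = ∑_{(a, b) ∈ Node(t)} ξ_b`, for the noise sequence `ξ`. -/
def tree {d : ℕ} (ξ : ℕ → Vec d) (t : ℕ) : Vec d :=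
  ∑ p ∈ node t, ξ p.2

/-! ### Online convex optimization algorithms -/

/-- A (possibly randomized) algorithm for online linear optimization: `act n r v` is the decision
in round `n + 1`, when the internal random seed is `r` and the losses of the first `n` rounds were
`⟨v 0, ·⟩, …, ⟨v (n - 1), ·⟩`. A deterministic algorithm is the case of a one-point `R`. -/
structure OCOAlgorithm (d : ℕ) (R : Type*) [MeasurableSpace R] where
  act : (n : ℕ) → R → (Fin n → Vec d) → Vec d
  measurable_act : ∀ n, Measurable (fun p : R × (Fin n → Vec d) => act n p.1 p.2)

/-- The domain of the algorithm is bounded by `D`: all its decisions have norm at most `D`. -/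
def OCOAlgorithm.DomainBounded {d : ℕ} {R : Type*} [MeasurableSpace R]
    (A : OCOAlgorithm d R) (D : ℝ) : Prop :=
  ∀ n r v, ‖A.act n r v‖ ≤ D

/-! ### The randomness consumed by a run -/

/-- A realization of everything random in a run. Epochs `k` and rounds `t` are numbered from `1`;
`z k t i` is the `i`-th data point of the batch of round `(k, t)`, `u k t i j` are its directions,
`s k t` is the interpolation weight, `ξ k t` the noise of the tree mechanism in epoch `k`, and
`r k` the seed of the online algorithm in epoch `k`. -/
structure Randomness (d : ℕ) (𝒵 R : Type*) where
  z : ℕ → ℕ → ℕ → 𝒵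
  u : ℕ → ℕ → ℕ → Fin d → Vec d
  s : ℕ → ℕ → ℝ
  ξ : ℕ → ℕ → Vec d
  r : ℕ → R

/-- The size of the batch in round `t`. -/
def batchSize (B₁ B₂ t : ℕ) : ℕ := if t = 1 then B₁ else B₂

/-- The rounds `(k, t)` with `1 ≤ k ≤ K` and `1 ≤ t ≤ T`. -/
abbrev Round (K T : ℕ) : Type := Finset.Icc 1 K × Finset.Icc 1 T

/-- The positions in the data set, which consists of `K (B₁ + B₂ (T - 1))` points and is
partitioned into the batches of the `K T` rounds. -/
abbrev DataIndex (K T B₁ B₂ : ℕ) : Type :=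
  Σ p : Round K T, Fin (batchSize B₁ B₂ p.2)

/-- The values of the five sources of randomness in a run with `K` epochs of `T` rounds. -/
abbrev SampleSpace (K T B₁ B₂ d : ℕ) (𝒵 R : Type*) : Type _ :=
  (DataIndex K T B₁ B₂ → 𝒵) × (DataIndex K T B₁ B₂ × Fin d → Vec d) ×
    (Round K T → ℝ) × (Round K T → Vec d) × (Finset.Icc 1 K → R)

/-- The part of the randomness that a run with `K` epochs of `T` rounds uses. -/
def Randomness.used {d : ℕ} {𝒵 R : Type*} (ρ : Randomness d 𝒵 R) (K T B₁ B₂ : ℕ) :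
    SampleSpace K T B₁ B₂ d 𝒵 R :=
  (fun q => ρ.z q.1.1 q.1.2 q.2,
    fun q => ρ.u q.1.1.1 q.1.1.2 q.1.2 q.2,
    fun p => ρ.s p.1 p.2,
    fun p => ρ.ξ p.1 p.2,
    fun k => ρ.r k)

/-- The joint law of the randomness used in a run: all variables are independent, the data points
have law `𝒟`, the directions are uniform on the sphere, the weights are uniform on `[0,1]`, the
noise of round `t` is `N(0, σ_t² I)`, and the seeds have law `ν`. -/
def sampleLaw (K T B₁ B₂ d : ℕ) {𝒵 R : Type*} [MeasurableSpace 𝒵] [MeasurableSpace R]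
    (𝒟 : Measure 𝒵) (σ : ℕ → ℝ) (ν : Measure R) : Measure (SampleSpace K T B₁ B₂ d 𝒵 R) :=
  (Measure.pi fun _ => 𝒟).prod <|
    (Measure.pi fun _ => uniformSphere d).prod <|
      (Measure.pi fun _ => uniformUnitInterval).prod <|
        (Measure.pi fun p : Round K T =>
          multivariateGaussian (0 : Vec d) ((σ p.2) ^ 2 • (1 : Matrix (Fin d) (Fin d) ℝ))).prod <|
          Measure.pi fun _ => ν

/-! ### Online-to-nonconvex conversion with the private variance-reduced oracle -/

/-- The state of an epoch after `n` completed rounds: the next iterate `x = x_{n+1}`, the last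
query point `w = w_n`, the last non-private estimate `g = g_n`, and the sequence `feedback` of the
private estimates `g̃_1, …, g̃_n`. For `n = 0` the entries `w` and `g` are placeholders, which are
never used. -/
structure EpochState (d n : ℕ) where
  x : Vec d
  w : Vec d
  g : Vec d
  feedback : Fin n → Vec d

section Run

variable {d : ℕ} {𝒵 R : Type*} [MeasurableSpace R]

/-- The rounds of epoch `k`, started at `x₁`: the state after `n` completed rounds. -/
def epoch (f : Vec d → 𝒵 → ℝ) (δ : ℝ) (B₁ B₂ : ℕ) (A : OCOAlgorithm d R)
    (ρ : Randomness d 𝒵 R) (k : ℕ) (x₁ : Vec d) : (n : ℕ) → EpochState d n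
  | 0 => { x := x₁, w := 0, g := 0, feedback := Fin.elim0 }
  | n + 1 =>
    let st := epoch f δ B₁ B₂ A ρ k x₁ n
    let Δ : Vec d := A.act n (ρ.r k) st.feedback
    let w : Vec d := st.x + ρ.s k (n + 1) • Δ
    let g : Vec d :=
      if n = 0 then
        gradEst f δ w (fun i : Fin B₁ => ρ.z k 1 i) (fun i : Fin B₁ => ρ.u k 1 i)
      else
        st.g + diffEst f δ w st.w (fun i : Fin B₂ => ρ.z k (n + 1) i)
          (fun i : Fin B₂ => ρ.u k (n + 1) i)
    { x := st.x + Δ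
      w := w
      g := g
      feedback := Fin.snoc st.feedback (g + tree (ρ.ξ k) (n + 1)) }

/-- The iterate after `m` completed epochs of `T` rounds, that is, the starting point
`x_1^{m+1}` of epoch `m + 1`; the first epoch starts at `x₁`. -/
def epochStart (f : Vec d → 𝒵 → ℝ) (δ : ℝ) (T B₁ B₂ : ℕ) (A : OCOAlgorithm d R)
    (x₁ : Vec d) (ρ : Randomness d 𝒵 R) : ℕ → Vec d
  | 0 => x₁
  | m + 1 => (epoch f δ B₁ B₂ A ρ (m + 1) (epochStart f δ T B₁ B₂ A x₁ ρ m) T).x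

/-- The query point `w_t^k`, for `k, t ≥ 1`. -/
def queryPoint (f : Vec d → 𝒵 → ℝ) (δ : ℝ) (T B₁ B₂ : ℕ) (A : OCOAlgorithm d R)
    (x₁ : Vec d) (ρ : Randomness d 𝒵 R) (k t : ℕ) : Vec d :=
  (epoch f δ B₁ B₂ A ρ k (epochStart f δ T B₁ B₂ A x₁ ρ (k - 1)) t).w

/-- The non-private variance-reduced estimate `g_t^k`, for `k, t ≥ 1`. -/
def oracleEstimate (f : Vec d → 𝒵 → ℝ) (δ : ℝ) (T B₁ B₂ : ℕ) (A : OCOAlgorithm d R)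
    (x₁ : Vec d) (ρ : Randomness d 𝒵 R) (k t : ℕ) : Vec d :=
  (epoch f δ B₁ B₂ A ρ k (epochStart f δ T B₁ B₂ A x₁ ρ (k - 1)) t).g

end Run

end O2NC

end

/-! The error `oracleError`, i.e. `g_t - ∇F̂_δ(w_t)`, is a martingale-type sum within an epoch. Once
the past and the query points are fixed, the batch of round `t` is still fresh, and the estimator
built from it is unbiased: the divergence theorem on the ball turns the gradient of the smoothing
into the sphere average `(d/δ) E[F(x + δu) u]` (`gradient_smoothing`, `gradient_smoothing_symm`).
Each round `t ≥ 2` therefore adds a centered increment, the cross term vanishes, and second moments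
grow only by the variance of that increment.

The variance of a batch of size `b` is at most `2dB²/b` when the scalar weights are bounded by `dB`
(`lintegral_batch_le`). Linear dependence on `d` has two sources. Given the data, averaging over `d`
directions reduces the crude `(dB)²` to `dB²`. Given only the data point, the mean over the sphere
already has norm at most `√d B`, since `E⟨u, e⟩² = ‖e‖²/d` (`norm_integral_smul_sphere_le`). For the
gradient estimator `B = L`; for the difference estimator `B = L‖x - y‖/δ`, and consecutive queries
are within `2D = 2δ/T` of each other, so at most `T` increments sum to order `dL²/(B₂T)`.

Conditioning on the past is realized by resampling: replacing the batch of one round by an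
independent copy preserves the joint law (`lintegral_sampleLaw_eq_replaceBatch`) and changes neither
earlier errors nor the query points up to that round. The tree noise and the seeds influence only
where queries are made, and the variance bounds are uniform in that. -/

open MeasureTheory ProbabilityTheory

noncomputable section

namespace O2NC

/-! ### Polar coordinates. -/

section Polar

open Metric Set Module

variable {E : Type*} [NormedAddCommGroup E] [NormedSpace ℝ E] [FiniteDimensional ℝ E]
  [Nontrivial E] [MeasurableSpace E] [BorelSpace E]

/-- Integration in polar coordinates. -/
theorem integral_eq_integral_Ioi_toSphere (μ : Measure E) [μ.IsAddHaarMeasure] {φ : E → ℝ}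
    (hφ : Integrable φ μ) :
    ∫ x, φ x ∂μ = ∫ r in Ioi (0 : ℝ), r ^ (finrank ℝ E - 1) *
      ∫ u : sphere (0 : E) 1, φ (r • (u : E)) ∂μ.toSphere := by
  have hmp := μ.measurePreserving_homeomorphUnitSphereProd
  have hemb := (homeomorphUnitSphereProd E).measurableEmbedding
  set ψ : sphere (0 : E) 1 × Ioi (0 : ℝ) → ℝ := fun p => φ (p.2.1 • (p.1 : E)) with hψ
  have hcomp : ∀ x : ({(0 : E)}ᶜ : Set E), ψ (homeomorphUnitSphereProd E x) = φ x := by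
    intro x
    have hx : ‖(x : E)‖ ≠ 0 := norm_ne_zero_iff.2 x.2
    simp [hψ, smul_smul, hx]
  have hψi : Integrable ψ (μ.toSphere.prod (.volumeIoiPow (finrank ℝ E - 1))) := by
    rw [← hmp.integrable_comp_emb hemb]
    have : ψ ∘ homeomorphUnitSphereProd E = φ ∘ Subtype.val := by
      ext x; exact hcomp x
    rw [this, ← integrableOn_iff_comap_subtypeVal (measurableSet_singleton _).compl]
    exact hφ.integrableOn
  calc ∫ x, φ x ∂μ = ∫ x : ({(0)}ᶜ : Set E), φ x.1 ∂(μ.comap (↑)) := by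
        rw [integral_subtype_comap (measurableSet_singleton _).compl φ,
          restrict_compl_singleton]
    _ = ∫ p, ψ p ∂μ.toSphere.prod (.volumeIoiPow (finrank ℝ E - 1)) := by
        rw [← hmp.integral_comp hemb]
        simp_rw [hcomp]
    _ = ∫ r : Ioi (0 : ℝ), (∫ u, ψ (u, r) ∂μ.toSphere)
          ∂(Measure.volumeIoiPow (finrank ℝ E - 1)) := integral_prod_symm ψ hψi
    _ = _ := by
        simp only [Measure.volumeIoiPow, ENNReal.ofReal, hψ]
        rw [integral_withDensity_eq_integral_smul,
          integral_subtype_comap measurableSet_Ioi fun a : ℝ =>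
            Real.toNNReal (a ^ (finrank ℝ E - 1)) •
              ∫ u : sphere (0 : E) 1, φ (a • (u : E)) ∂μ.toSphere,
          setIntegral_congr_fun measurableSet_Ioi fun x hx => ?_]
        · rw [NNReal.smul_def, Real.coe_toNNReal _ (pow_nonneg hx.out.le _), smul_eq_mul]
        · exact (measurable_subtype_coe.pow_const _).real_toNNReal

end Polar

/-! ### The divergence theorem on the ball for Lipschitz functions. -/

section Divergence

open Metric Set Module Filter Topology

variable {E : Type*} [NormedAddCommGroup E]

/-- The cone of height `ρ` over the ball of radius `ρ`. -/
def coneFun (ρ : ℝ) (x : E) : ℝ := max (ρ - ‖x‖) 0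

theorem lipschitzWith_coneFun (ρ : ℝ) : LipschitzWith 1 (coneFun ρ : E → ℝ) := by
  refine LipschitzWith.of_dist_le_mul fun x y => ?_
  rw [Real.dist_eq, NNReal.coe_one, one_mul, dist_eq_norm]
  refine (abs_max_sub_max_le_abs _ _ _).trans ?_
  rw [sub_sub_sub_cancel_left, norm_sub_rev]
  exact abs_norm_sub_norm_le _ _

variable [InnerProductSpace ℝ E]

theorem hasCompactSupport_coneFun [FiniteDimensional ℝ E] (ρ : ℝ) :
    HasCompactSupport (coneFun ρ : E → ℝ) := by
  refine HasCompactSupport.intro (isCompact_closedBall 0 ρ) fun x hx => ?_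
  rw [mem_closedBall_zero_iff, not_le] at hx
  exact max_eq_right (by linarith)

/-- The cone has gradient `-x/‖x‖` inside the ball and `0` outside; the direction `-e` is the one
produced by integration by parts. The apex and the rim are excluded, and both are null sets. -/
theorem lineDeriv_coneFun_neg {ρ : ℝ} {x : E} (e : E) (hx0 : x ≠ 0) (hx : ‖x‖ ≠ ρ) :
    lineDeriv ℝ (coneFun ρ) x (-e) =
      (ball (0 : E) ρ).indicator (fun y => inner ℝ y e / ‖y‖) x := by
  rcases lt_or_gt_of_ne hx with h | h
  · rw [indicator_of_mem (by simpa using h)]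
    have hn : HasFDerivAt (fun y : E => ‖y‖) (‖x‖⁻¹ • innerSL ℝ x) x := by
      have := (hasStrictFDerivAt_norm_sq x).hasFDerivAt.sqrt (by simpa using hx0)
      simp only [Real.sqrt_sq (norm_nonneg _)] at this
      convert this using 1
      ext y
      simp
      ring
    have hd : HasFDerivAt (fun y : E => ρ - ‖y‖) (-(‖x‖⁻¹ • innerSL ℝ x)) x := hn.const_sub ρ
    have hev : (coneFun ρ : E → ℝ) =ᶠ[𝓝 x] fun y => ρ - ‖y‖ := by
      filter_upwards [(isOpen_lt continuous_norm continuous_const).mem_nhds h] with y hy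
      exact max_eq_left (sub_nonneg.2 (le_of_lt hy))
    rw [((hd.congr_of_eventuallyEq hev).hasLineDerivAt (-e)).lineDeriv]
    simp [div_eq_inv_mul]
  · rw [indicator_of_notMem (by simpa using h.le)]
    have hev : (coneFun ρ : E → ℝ) =ᶠ[𝓝 x] fun _ => 0 := by
      filter_upwards [(isOpen_lt continuous_const continuous_norm).mem_nhds h] with y hy
      exact max_eq_right (sub_nonpos.2 (le_of_lt hy))
    rw [(((hasFDerivAt_const (0 : ℝ) x).congr_of_eventuallyEq hev).hasLineDerivAt (-e)).lineDeriv]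
    simp

variable [FiniteDimensional ℝ E] [Nontrivial E] [MeasurableSpace E] [BorelSpace E]

/-- Integration by parts moves the derivative from `h` to the compactly supported cone, whose
derivative is purely radial; polar coordinates then give an integral over radii up to `ρ`.
Differentiating this identity in `ρ` yields the divergence theorem. -/
theorem integral_lineDeriv_mul_coneFun (μ : Measure E) [μ.IsAddHaarMeasure] {h : E → ℝ}
    {C : NNReal} (hh : LipschitzWith C h) (e : E) {ρ : ℝ} (hρ : 0 < ρ) :
    ∫ x, lineDeriv ℝ h x e * coneFun ρ x ∂μ = ∫ r in (0 : ℝ)..ρ, r ^ (finrank ℝ E - 1) *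
      ∫ u : sphere (0 : E) 1, h (r • (u : E)) * inner ℝ (u : E) e ∂μ.toSphere := by
  rw [hh.integral_lineDeriv_mul_eq (lipschitzWith_coneFun ρ) (hasCompactSupport_coneFun ρ) e]
  have hae : ∀ᵐ x ∂μ, x ≠ 0 ∧ ‖x‖ ≠ ρ := by
    have h1 : ∀ᵐ x ∂μ, x ∉ ({0} : Set E) := measure_eq_zero_iff_ae_notMem.1 (measure_singleton _)
    have h2 : ∀ᵐ x ∂μ, x ∉ sphere (0 : E) ρ :=
      measure_eq_zero_iff_ae_notMem.1 (Measure.addHaar_sphere μ 0 ρ)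
    filter_upwards [h1, h2] with x hx1 hx2
    exact ⟨hx1, by simpa using hx2⟩
  set φ : E → ℝ := (ball (0 : E) ρ).indicator fun y => inner ℝ y e / ‖y‖ * h y with hφ
  have hcongr : ∀ᵐ x ∂μ, lineDeriv ℝ (coneFun ρ) x (-e) * h x = φ x := by
    filter_upwards [hae] with x hx
    rw [lineDeriv_coneFun_neg e hx.1 hx.2, hφ, indicator_mul_left]
  have hφi : Integrable φ μ := by
    refine IntegrableOn.integrable_indicator ?_ measurableSet_ball
    obtain ⟨M, hM⟩ := (isCompact_closedBall (0 : E) ρ).exists_bound_of_continuousOn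
      hh.continuous.continuousOn
    refine Measure.integrableOn_of_bounded (M := ‖e‖ * M) measure_ball_lt_top.ne ?_ ?_
    · have : Measurable fun y : E => inner ℝ y e / ‖y‖ * h y :=
        ((measurable_id.inner_const).div measurable_norm).mul hh.continuous.measurable
      exact this.aestronglyMeasurable
    · filter_upwards [ae_restrict_mem measurableSet_ball] with y hy
      rw [norm_mul]
      refine mul_le_mul ?_ (hM y (ball_subset_closedBall hy)) (norm_nonneg _) (norm_nonneg _)
      rw [norm_div, norm_norm]
      exact div_le_of_le_mul₀ (norm_nonneg _) (norm_nonneg _)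
        ((norm_inner_le_norm y e).trans_eq (mul_comm _ _))
  rw [integral_congr_ae hcongr, integral_eq_integral_Ioi_toSphere μ hφi,
    intervalIntegral.integral_of_le hρ.le, integral_Ioc_eq_integral_Ioo]
  rw [← Ioi_inter_Iio, ← setIntegral_indicator measurableSet_Iio]
  refine setIntegral_congr_fun measurableSet_Ioi fun r hr => ?_
  have hr0 : 0 < r := hr
  have hn : ∀ u : sphere (0 : E) 1, ‖r • (u : E)‖ = r := fun u => by
    simp [norm_smul, abs_of_pos hr0]
  by_cases hrρ : r < ρ
  · rw [indicator_of_mem (by exact hrρ)]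
    congr 1
    refine integral_congr_ae (.of_forall fun u => ?_)
    simp only [hφ]
    rw [indicator_of_mem (by simpa [hn u] using hrρ), hn u, real_inner_smul_left]
    field_simp
  · rw [indicator_of_notMem (by exact hrρ)]
    have : ∀ u : sphere (0 : E) 1, φ (r • (u : E)) = 0 := fun u =>
      indicator_of_notMem (by simpa [hn u] using hrρ) _
    simp [this]

/-- The divergence theorem on the unit ball for the field `h e`, where `h` is Lipschitz. -/
theorem integral_closedBall_lineDeriv (μ : Measure E) [μ.IsAddHaarMeasure] {h : E → ℝ}
    {C : NNReal} (hh : LipschitzWith C h) (e : E) :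
    ∫ x in closedBall (0 : E) 1, lineDeriv ℝ h x e ∂μ =
      ∫ u : sphere (0 : E) 1, h u * inner ℝ (u : E) e ∂μ.toSphere := by
  set M : ℝ → ℝ := fun r => r ^ (finrank ℝ E - 1) *
      ∫ u : sphere (0 : E) 1, h (r • (u : E)) * inner ℝ (u : E) e ∂μ.toSphere with hM
  have hMc : Continuous M := by
    refine (continuous_pow _).mul ?_
    have hc : Continuous (Function.uncurry fun (r : ℝ) (u : sphere (0 : E) 1) =>
        h (r • (u : E)) * inner ℝ (u : E) e) := by
      have := hh.continuous
      unfold Function.uncurry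
      fun_prop
    simpa using continuous_parametric_integral_of_continuous (μ := μ.toSphere) hc isCompact_univ
  -- The right derivative at `ρ = 1` of the radial side is its integrand there, the sphere integral.
  have hR : Tendsto (fun ρ : ℝ => (ρ - 1)⁻¹ * ((∫ r in (0 : ℝ)..ρ, M r) - ∫ r in (0 : ℝ)..1, M r))
      (𝓝[>] 1) (𝓝 (M 1)) := by
    have := (hMc.integral_hasStrictDerivAt 0 1).hasDerivAt.hasDerivWithinAt (s := Ioi 1)
    rw [hasDerivWithinAt_iff_tendsto_slope' (by simp)] at this
    exact this
  -- On the volume side the difference quotient of the cones tends to the indicator of the closed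
  -- ball. It is bounded by `1` and, for `1 < ρ < 2`, supported in the ball of radius `2`, so
  -- dominated convergence applies.
  have hL : Tendsto (fun ρ : ℝ => (ρ - 1)⁻¹ * ((∫ x, lineDeriv ℝ h x e * coneFun ρ x ∂μ) -
      ∫ x, lineDeriv ℝ h x e * coneFun 1 x ∂μ))
      (𝓝[>] 1) (𝓝 (∫ x, (closedBall (0 : E) 1).indicator (fun x => lineDeriv ℝ h x e) x ∂μ)) := by
    have hmeas : AEStronglyMeasurable (fun x => lineDeriv ℝ h x e) μ :=
      aestronglyMeasurable_lineDeriv hh.continuous μ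
    have hint : ∀ ρ : ℝ, Integrable (fun x => lineDeriv ℝ h x e * coneFun ρ x) μ := fun ρ =>
      ((lipschitzWith_coneFun ρ).continuous.integrable_of_hasCompactSupport
        (hasCompactSupport_coneFun ρ)).bdd_mul hmeas
        (.of_forall fun x => norm_lineDeriv_le_of_lipschitz ℝ hh)
    have key : ∀ ρ : ℝ, (ρ - 1)⁻¹ * ((∫ x, lineDeriv ℝ h x e * coneFun ρ x ∂μ) -
        ∫ x, lineDeriv ℝ h x e * coneFun 1 x ∂μ) =
        ∫ x, lineDeriv ℝ h x e * ((ρ - 1)⁻¹ * (coneFun ρ x - coneFun 1 x)) ∂μ := by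
      intro ρ
      rw [← integral_sub (hint ρ) (hint 1), ← integral_const_mul]
      congr 1 with x
      ring
    simp_rw [key]
    have hq : ∀ ρ ∈ Ioi (1 : ℝ), ∀ x : E, |(ρ - 1)⁻¹ * (coneFun ρ x - coneFun 1 x)| ≤ 1 := by
      intro ρ hρ x
      have hρ' : (0 : ℝ) < ρ - 1 := sub_pos.2 hρ
      rw [abs_mul, abs_inv, abs_of_pos hρ', inv_mul_le_iff₀ hρ', mul_one]
      refine (abs_max_sub_max_le_abs _ _ _).trans ?_
      rw [sub_sub_sub_cancel_right, abs_of_pos hρ']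
    refine tendsto_integral_filter_of_dominated_convergence
      ((closedBall (0 : E) 2).indicator fun _ => C * ‖e‖) ?_ ?_ ?_ ?_
    · refine .of_forall fun ρ => hmeas.mul ?_
      exact (((lipschitzWith_coneFun ρ).continuous.sub
        (lipschitzWith_coneFun 1).continuous).const_mul _).aestronglyMeasurable
    · filter_upwards [Ioo_mem_nhdsGT (show (1 : ℝ) < 2 by norm_num)] with ρ hρ
      refine .of_forall fun x => ?_
      by_cases hx : x ∈ closedBall (0 : E) 2
      · rw [indicator_of_mem hx, norm_mul]
        exact (mul_le_of_le_one_right (norm_nonneg _) (hq ρ hρ.1 x)).trans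
          (norm_lineDeriv_le_of_lipschitz ℝ hh)
      · rw [indicator_of_notMem hx]
        rw [mem_closedBall_zero_iff, not_le] at hx
        have h1 : coneFun ρ x = 0 := max_eq_right (by linarith [hρ.2])
        have h2 : coneFun 1 x = 0 := max_eq_right (by linarith)
        simp [h1, h2]
    · exact IntegrableOn.integrable_indicator
        (integrableOn_const measure_closedBall_lt_top.ne) measurableSet_closedBall
    · refine .of_forall fun x => ?_
      by_cases hx : ‖x‖ ≤ 1
      · rw [indicator_of_mem (by simpa using hx)]
        refine tendsto_const_nhds.congr' ?_
        filter_upwards [self_mem_nhdsWithin] with ρ hρ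
        have hρ' : (1 : ℝ) < ρ := hρ
        have h1 : coneFun ρ x = ρ - ‖x‖ := max_eq_left (by linarith)
        have h2 : coneFun 1 x = 1 - ‖x‖ := max_eq_left (by linarith)
        have h3 : ρ - 1 ≠ 0 := by linarith
        rw [h1, h2, sub_sub_sub_cancel_right, inv_mul_cancel₀ h3, mul_one]
      · rw [indicator_of_notMem (by simpa using hx)]
        rw [not_le] at hx
        refine tendsto_const_nhds.congr' ?_
        filter_upwards [Ioo_mem_nhdsGT hx] with ρ hρ
        have h1 : coneFun ρ x = 0 := max_eq_right (by linarith [hρ.2])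
        have h2 : coneFun 1 x = 0 := max_eq_right (by linarith)
        simp [h1, h2]
  rw [integral_indicator measurableSet_closedBall] at hL
  have heq : (fun ρ : ℝ => (ρ - 1)⁻¹ * ((∫ x, lineDeriv ℝ h x e * coneFun ρ x ∂μ) -
      ∫ x, lineDeriv ℝ h x e * coneFun 1 x ∂μ)) =ᶠ[𝓝[>] 1]
      fun ρ : ℝ => (ρ - 1)⁻¹ * ((∫ r in (0 : ℝ)..ρ, M r) - ∫ r in (0 : ℝ)..1, M r) := by
    filter_upwards [self_mem_nhdsWithin] with ρ hρ
    rw [integral_lineDeriv_mul_coneFun μ hh e (zero_lt_one.trans hρ),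
      integral_lineDeriv_mul_coneFun μ hh e zero_lt_one]
  have := tendsto_nhds_unique (hL.congr' heq) hR
  simpa [hM] using this

end Divergence

/-! ### Uniform measures and the gradient of the smoothing. -/

section Uniform

open Metric Set Module Filter

variable {d : ℕ}

instance : IsProbabilityMeasure (uniformBall d) :=
  cond_isProbabilityMeasure_of_finite (measure_closedBall_pos _ _ one_pos).ne'
    measure_closedBall_lt_top.ne

instance [NeZero d] : IsProbabilityMeasure (uniformSphere d) := by
  have : IsProbabilityMeasure (cond (volume : Measure (Vec d)).toSphere univ) :=
    cond_isProbabilityMeasure (by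
      rw [Measure.toSphere_apply_univ]
      exact mul_ne_zero (by simpa using NeZero.ne d) (measure_ball_pos _ _ one_pos).ne')
  exact Measure.isProbabilityMeasure_map measurable_subtype_coe.aemeasurable

theorem ae_norm_eq_one_uniformSphere : ∀ᵐ u ∂uniformSphere d, ‖u‖ = 1 := by
  rw [uniformSphere, ae_map_iff measurable_subtype_coe.aemeasurable
    (measurableSet_eq_fun measurable_norm measurable_const)]
  exact .of_forall fun u => by simp

theorem integral_uniformSphere (φ : Vec d → ℝ) :
    ∫ u, φ u ∂uniformSphere d = (d * volume.real (ball (0 : Vec d) 1))⁻¹ *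
      ∫ u : sphere (0 : Vec d) 1, φ u ∂(volume : Measure (Vec d)).toSphere := by
  rw [uniformSphere, (MeasurableEmbedding.subtype_coe isClosed_sphere.measurableSet).integral_map,
    ProbabilityTheory.cond, Measure.restrict_univ, integral_smul_measure]
  simp [measureReal_def]

theorem integral_uniformBall [NeZero d] (φ : Vec d → ℝ) :
    ∫ v, φ v ∂uniformBall d = (volume.real (ball (0 : Vec d) 1))⁻¹ *
      ∫ v in closedBall (0 : Vec d) 1, φ v := by
  rw [uniformBall, ProbabilityTheory.cond, integral_smul_measure, Measure.addHaar_closedBall_eq_addHaar_ball]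
  simp [measureReal_def]

theorem Continuous.integrable_uniformSphere [NeZero d] {G : Type*} [NormedAddCommGroup G]
    {φ : Vec d → G} (hφ : Continuous φ) : Integrable φ (uniformSphere d) := by
  obtain ⟨M, hM⟩ := (isCompact_sphere (0 : Vec d) 1).exists_bound_of_continuousOn hφ.continuousOn
  refine Integrable.of_bound hφ.aestronglyMeasurable M ?_
  filter_upwards [ae_norm_eq_one_uniformSphere] with u hu
  exact hM u (by simpa using hu)

theorem Continuous.integrable_uniformBall {G : Type*} [NormedAddCommGroup G]
    {φ : Vec d → G} (hφ : Continuous φ) : Integrable φ (uniformBall d) := by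
  obtain ⟨M, hM⟩ := (isCompact_closedBall (0 : Vec d) 1).exists_bound_of_continuousOn
    hφ.continuousOn
  refine Integrable.of_bound hφ.aestronglyMeasurable M ?_
  filter_upwards [ae_cond_mem measurableSet_closedBall] with u hu
  exact hM u hu

theorem integral_comp_neg_uniformBall [NeZero d] (φ : Vec d → ℝ) :
    ∫ v, φ (-v) ∂uniformBall d = ∫ v, φ v ∂uniformBall d := by
  rw [integral_uniformBall, integral_uniformBall]
  congr 1
  have := (Measure.measurePreserving_neg (volume : Measure (Vec d))).setIntegral_preimage_emb
    (MeasurableEquiv.neg (Vec d)).measurableEmbedding φ (closedBall 0 1)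
  rw [← this]
  simp

theorem smoothing_neg [NeZero d] (δ : ℝ) (F : Vec d → ℝ) : smoothing (-δ) F = smoothing δ F := by
  ext x
  simpa [smoothing] using integral_comp_neg_uniformBall fun v => F (x + δ • v)

theorem lipschitzWith_comp_affine {F : Vec d → ℝ} {C : NNReal} (hF : LipschitzWith C F) (δ : ℝ)
    (x : Vec d) : LipschitzWith (C * ‖δ‖₊) fun v => F (x + δ • v) := by
  refine hF.comp (LipschitzWith.of_dist_le_mul fun v w => ?_)
  rw [dist_add_left, dist_smul₀]
  simp

/-- Rademacher's theorem gives differentiability at almost every `v`, and the Lipschitz constant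
dominates the difference quotients. Moving `x` by `a` amounts to moving `v` by `δ⁻¹ a`, so the
derivative is expressed in the variable `v`, to which the divergence theorem applies. -/
theorem hasFDerivAt_smoothing {F : Vec d → ℝ} {C : NNReal} (hF : LipschitzWith C F) {δ : ℝ}
    (hδ : δ ≠ 0) (x : Vec d) :
    (∀ᵐ v ∂uniformBall d, DifferentiableAt ℝ (fun v => F (x + δ • v)) v) ∧
    Integrable (fun v => δ⁻¹ • fderiv ℝ (fun v => F (x + δ • v)) v) (uniformBall d) ∧
    HasFDerivAt (smoothing δ F)
      (∫ v, δ⁻¹ • fderiv ℝ (fun v => F (x + δ • v)) v ∂uniformBall d) x := by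
  have hder : ∀ᵐ v ∂uniformBall d, DifferentiableAt ℝ (fun v => F (x + δ • v)) v :=
    cond_absolutelyContinuous.ae_le (lipschitzWith_comp_affine hF δ x).ae_differentiableAt
  have hFi : ∀ y, Integrable (fun v => F (y + δ • v)) (uniformBall d) := fun y =>
    Continuous.integrable_uniformBall (hF.continuous.comp (by fun_prop))
  refine ⟨hder, hasFDerivAt_integral_of_dominated_loc_of_lip (bound := fun _ => (C : ℝ)) univ_mem
    (.of_forall fun y => (hFi y).aestronglyMeasurable) (hFi x)
    ((measurable_fderiv ℝ fun v => F (x + δ • v)).const_smul δ⁻¹).aestronglyMeasurable ?_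
    (integrable_const _) ?_⟩
  · refine .of_forall fun v => LipschitzOnWith.of_dist_le_mul fun y _ z _ => ?_
    simpa using hF.dist_le_mul (y + δ • v) (z + δ • v)
  · filter_upwards [hder] with v hv
    have h1 : HasFDerivAt (fun y : Vec d => v + δ⁻¹ • (y - x))
        (δ⁻¹ • ContinuousLinearMap.id ℝ (Vec d)) x :=
      (((hasFDerivAt_id x).sub_const x).const_smul δ⁻¹).const_add v
    have h2 : HasFDerivAt (fun v => F (x + δ • v)) (fderiv ℝ (fun v => F (x + δ • v)) v)
        (v + δ⁻¹ • (x - x)) := by simpa using hv.hasFDerivAt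
    have h3 := h2.comp x h1
    rw [ContinuousLinearMap.comp_smul, ContinuousLinearMap.comp_id] at h3
    refine h3.congr_of_eventuallyEq (.of_forall fun y => ?_)
    simp only [Function.comp_apply, smul_add, smul_smul, mul_inv_cancel₀ hδ, one_smul]
    congr 1
    abel

variable [NeZero d]

/-- The factor `d` is the ratio of the surface area of the sphere to the volume of the ball. -/
theorem integral_lineDeriv_uniformBall {h : Vec d → ℝ} {C : NNReal} (hh : LipschitzWith C h)
    (e : Vec d) :
    ∫ v, lineDeriv ℝ h v e ∂uniformBall d = d * ∫ u, h u * inner ℝ u e ∂uniformSphere d := by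
  have hd : (d : ℝ) ≠ 0 := NeZero.ne _
  rw [integral_uniformBall, integral_uniformSphere, integral_closedBall_lineDeriv volume hh e,
    mul_inv, mul_assoc, mul_inv_cancel_left₀ hd]

/-- This is the divergence theorem for the linear function `⟨e, ·⟩`, whose derivative along `e` is
constant. -/
theorem integral_inner_sq_uniformSphere (e : Vec d) :
    ∫ u, (inner ℝ u e) ^ 2 ∂uniformSphere d = ‖e‖ ^ 2 / d := by
  have hd : (d : ℝ) ≠ 0 := NeZero.ne _
  have h := integral_lineDeriv_uniformBall (d := d) (innerSL ℝ e).lipschitz e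
  have h1 : ∀ v, lineDeriv ℝ (innerSL ℝ e) v e = ‖e‖ ^ 2 := fun v => by
    rw [((innerSL ℝ e).hasFDerivAt.hasLineDerivAt e).lineDeriv]
    simp
  simp_rw [h1] at h
  rw [integral_const, probReal_univ, one_smul] at h
  rw [h, mul_div_cancel_left₀ _ hd]
  refine integral_congr_ae (.of_forall fun u => ?_)
  simp [sq, real_inner_comm]

/-- Tested against each `e`, the derivative under the integral is a ball average of line
derivatives, hence a sphere average. Negative `δ` is allowed, which the symmetrization below
exploits. -/
theorem hasGradientAt_smoothing {F : Vec d → ℝ} {C : NNReal} (hF : LipschitzWith C F) {δ : ℝ}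
    (hδ : δ ≠ 0) (x : Vec d) :
    HasGradientAt (smoothing δ F)
      (((d : ℝ) / δ) • ∫ u, F (x + δ • u) • u ∂uniformSphere d) x := by
  obtain ⟨hder, hint, hmain⟩ := hasFDerivAt_smoothing hF hδ x
  have hh := lipschitzWith_comp_affine hF δ x
  have hi : Integrable (fun u => F (x + δ • u) • u) (uniformSphere d) :=
    Continuous.integrable_uniformSphere (hh.continuous.smul continuous_id)
  rw [hasGradientAt_iff_hasFDerivAt]
  refine hmain.congr_fderiv (ContinuousLinearMap.ext fun e => ?_)
  rw [ContinuousLinearMap.integral_apply hint, InnerProductSpace.toDual_apply_apply,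
    real_inner_smul_left, real_inner_comm,
    ← integral_inner hi]
  have hl : ∫ v, (δ⁻¹ • fderiv ℝ (fun v => F (x + δ • v)) v) e ∂uniformBall d =
      δ⁻¹ * ∫ v, lineDeriv ℝ (fun v => F (x + δ • v)) v e ∂uniformBall d := by
    rw [← integral_const_mul]
    refine integral_congr_ae ?_
    filter_upwards [hder] with v hv
    rw [hv.lineDeriv_eq_fderiv]
    rfl
  rw [hl, integral_lineDeriv_uniformBall hh, div_eq_inv_mul, mul_assoc]
  congr 2
  refine integral_congr_ae (.of_forall fun u => ?_)
  simp only [real_inner_smul_right, real_inner_comm u e]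

theorem gradient_smoothing {F : Vec d → ℝ} {C : NNReal} (hF : LipschitzWith C F) {δ : ℝ}
    (hδ : δ ≠ 0) (x : Vec d) :
    gradient (smoothing δ F) x = ((d : ℝ) / δ) • ∫ u, F (x + δ • u) • u ∂uniformSphere d :=
  (hasGradientAt_smoothing hF hδ x).gradient

theorem differentiable_smoothing {F : Vec d → ℝ} {C : NNReal} (hF : LipschitzWith C F) {δ : ℝ}
    (hδ : δ ≠ 0) : Differentiable ℝ (smoothing δ F) :=
  fun x => (hasGradientAt_smoothing hF hδ x).differentiableAt

/-- The symmetrized form of `gradient_smoothing`. -/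
theorem gradient_smoothing_symm {F : Vec d → ℝ} {C : NNReal} (hF : LipschitzWith C F) {δ : ℝ}
    (hδ : δ ≠ 0) (x : Vec d) :
    gradient (smoothing δ F) x =
      ∫ u, ((d : ℝ) / (2 * δ) * (F (x + δ • u) - F (x - δ • u))) • u ∂uniformSphere d := by
  have h1 := gradient_smoothing hF hδ x
  have h2 := gradient_smoothing hF (neg_ne_zero.2 hδ) x
  rw [smoothing_neg] at h2
  have hi : ∀ r : ℝ, Integrable (fun u => F (x + r • u) • u) (uniformSphere d) := fun r =>
    Continuous.integrable_uniformSphere ((hF.continuous.comp (by fun_prop)).smul continuous_id)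
  have h3 : ∀ u : Vec d, ((d : ℝ) / (2 * δ) * (F (x + δ • u) - F (x - δ • u))) • u =
      ((d : ℝ) / (2 * δ)) • (F (x + δ • u) • u - F (x + (-δ) • u) • u) := fun u => by
    rw [neg_smul, ← sub_eq_add_neg, ← sub_smul, smul_smul]
  simp_rw [h3]
  rw [integral_smul, integral_sub (hi _) (hi _)]
  -- One half is expressed by the formula for `δ`, the other by the formula for `-δ`.
  have h4 : gradient (smoothing δ F) x = (2⁻¹ : ℝ) • gradient (smoothing δ F) x +
      (2⁻¹ : ℝ) • gradient (smoothing δ F) x := by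
    rw [← add_smul]; norm_num
  rw [h4]
  nth_rewrite 1 [h1]
  rw [h2, smul_smul, smul_smul, smul_sub, sub_eq_add_neg, ← neg_smul]
  congr 2 <;> field_simp

end Uniform

/-! ### Second moments of sums of independent centered variables. -/

section Variance

open scoped ENNReal

variable {ι κ α : Type*} [Fintype ι] [Fintype κ] [MeasurableSpace α] {μ : Measure α}
  [IsProbabilityMeasure μ]

theorem memLp_add_sum_centered {Y : κ → α → ℝ} (hY : ∀ k, MemLp (Y k) 2 μ) (e : κ → ι)
    (a r : ℝ) :
    MemLp (fun ω : ι → α => a + r * ∑ k, (Y k (ω (e k)) - ∫ x, Y k x ∂μ)) 2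
      (Measure.pi fun _ => μ) := by
  have hS : ∀ k, MemLp (fun ω : ι → α => Y k (ω (e k)) - ∫ x, Y k x ∂μ) 2
      (Measure.pi fun _ => μ) := fun k =>
    ((hY k).sub (memLp_const (∫ x, Y k x ∂μ))).comp_measurePreserving
      (measurePreserving_eval (fun _ : ι => μ) (e k))
  have hsum := memLp_finsetSum Finset.univ fun k _ => hS k
  exact (memLp_const a).add (hsum.const_mul r)

/-- The sum is centered, so the shift `a` contributes exactly `a ^ 2`. Injectivity of `e` makes the
summands depend on distinct coordinates, hence variances add, and each is at most the second moment.
-/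
theorem integral_add_sum_centered_sq_le {Y : κ → α → ℝ} (hm : ∀ k, Measurable (Y k))
    (hY : ∀ k, MemLp (Y k) 2 μ) {e : κ → ι} (he : e.Injective) (a r : ℝ) :
    ∫ ω : ι → α, (a + r * ∑ k, (Y k (ω (e k)) - ∫ x, Y k x ∂μ)) ^ 2 ∂(Measure.pi fun _ => μ)
      ≤ a ^ 2 + r ^ 2 * ∑ k, ∫ x, Y k x ^ 2 ∂μ := by
  set S : κ → (ι → α) → ℝ := fun k ω => Y k (ω (e k)) - ∫ x, Y k x ∂μ with hS
  set W : (ι → α) → ℝ := fun ω => a + r * ∑ k, S k ω with hW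
  have hWm : MemLp W 2 (Measure.pi fun _ => μ) := memLp_add_sum_centered hY e a r
  have hmp : ∀ k, MeasurePreserving (fun ω : ι → α => ω (e k)) (Measure.pi fun _ => μ) μ :=
    fun k => measurePreserving_eval (fun _ : ι => μ) (e k)
  have hSm : ∀ k, MemLp (S k) 2 (Measure.pi fun _ => μ) := fun k =>
    ((hY k).sub (memLp_const _)).comp_measurePreserving (hmp k)
  have hSmean : ∀ k, ∫ ω, S k ω ∂(Measure.pi fun _ => μ) = 0 := fun k => by
    have h1 : ∫ ω : ι → α, Y k (ω (e k)) ∂(Measure.pi fun _ => μ) = ∫ x, Y k x ∂μ := by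
      rw [← (hmp k).map_eq, integral_map (hmp k).aemeasurable (hm k).aestronglyMeasurable]
      rw [(hmp k).map_eq]
    have h2 : Integrable (fun ω : ι → α => Y k (ω (e k))) (Measure.pi fun _ => μ) :=
      ((hY k).comp_measurePreserving (hmp k)).integrable one_le_two
    rw [hS, integral_sub h2 (integrable_const _), h1]
    simp
  have hWmean : ∫ ω, W ω ∂(Measure.pi fun _ => μ) = a := by
    have h1 : Integrable (fun ω => ∑ k, S k ω) (Measure.pi fun _ => μ) :=
      integrable_finsetSum _ fun k _ => (hSm k).integrable one_le_two
    rw [hW, integral_add (integrable_const _) (h1.const_mul r), integral_const_mul,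
      integral_finsetSum _ fun k _ => (hSm k).integrable one_le_two]
    simp [hSmean]
  have hind : iIndepFun S (Measure.pi fun _ : ι => μ) :=
    ((iIndepFun_pi (μ := fun _ : ι => μ) (X := fun _ => id) fun _ => aemeasurable_id).precomp
      he).comp (fun k x => Y k x - ∫ x, Y k x ∂μ) fun k => (hm k).sub_const _
  have hvar : Var[W; Measure.pi fun _ => μ] ≤ r ^ 2 * ∑ k, ∫ x, Y k x ^ 2 ∂μ := by
    have h1 : AEStronglyMeasurable (fun ω => r * ∑ k, S k ω) (Measure.pi fun _ : ι => μ) :=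
      (memLp_finsetSum _ fun k _ => hSm k).aestronglyMeasurable.const_mul r
    rw [hW, variance_const_add h1, variance_const_mul]
    gcongr
    have h2 : (fun ω => ∑ k, S k ω) = ∑ k, S k := by ext; simp
    rw [h2, IndepFun.variance_sum (fun k _ => hSm k) fun i _ j _ hij => hind.indepFun hij]
    gcongr with k
    rw [(hmp k).variance_fun_comp (f := fun x => Y k x - ∫ x, Y k x ∂μ)
      ((hm k).sub_const _).aemeasurable, variance_sub_const (hm k).aestronglyMeasurable]
    exact variance_le_expectation_sq (hm k).aestronglyMeasurable
  rw [variance_eq_sub hWm, hWmean] at hvar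
  simp only [Pi.pow_apply] at hvar
  linarith

/-- Second moment of an average of independent centered vectors, shifted by `v`. -/
theorem lintegral_norm_sq_add_sum_centered_le {d : ℕ} {X : κ → α → Vec d} {M : ℝ}
    (hm : ∀ k, Measurable (X k)) (hX : ∀ k, ∀ᵐ x ∂μ, ‖X k x‖ ≤ M) {e : κ → ι}
    (he : e.Injective) (v : Vec d) (r : ℝ) :
    ∫⁻ ω : ι → α, ENNReal.ofReal (‖v + r • ∑ k, (X k (ω (e k)) - ∫ x, X k x ∂μ)‖ ^ 2)
      ∂(Measure.pi fun _ => μ) ≤ ENNReal.ofReal (‖v‖ ^ 2 + r ^ 2 * (Fintype.card κ * M ^ 2)) := by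
  have hXi : ∀ k, Integrable (X k) μ := fun k =>
    Integrable.of_bound (hm k).aestronglyMeasurable M (hX k)
  have hcm : ∀ c k, Measurable fun x => X k x c := fun c k => by
    have := hm k
    fun_prop
  have hcb : ∀ c k, ∀ᵐ x ∂μ, ‖X k x c‖ ≤ M := fun c k => by
    filter_upwards [hX k] with x hx
    exact (PiLp.norm_apply_le _ _).trans hx
  have hcL : ∀ c k, MemLp (fun x => X k x c) 2 μ := fun c k =>
    MemLp.of_bound (hcm c k).aestronglyMeasurable M (hcb c k)
  have hmean : ∀ c k, (∫ x, X k x ∂μ) c = ∫ x, X k x c ∂μ := fun c k =>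
    ((EuclideanSpace.proj c : Vec d →L[ℝ] ℝ).integral_comp_comm (hXi k)).symm
  -- The squared Euclidean norm splits into coordinates, reducing to the scalar case.
  have hcoord : ∀ ω : ι → α, ‖v + r • ∑ k, (X k (ω (e k)) - ∫ x, X k x ∂μ)‖ ^ 2 =
      ∑ c, (v c + r * ∑ k, (X k (ω (e k)) c - ∫ x, X k x c ∂μ)) ^ 2 := fun ω => by
    rw [EuclideanSpace.real_norm_sq_eq]
    simp [hmean]
  have hint : ∀ c, Integrable (fun ω : ι → α =>
      (v c + r * ∑ k, (X k (ω (e k)) c - ∫ x, X k x c ∂μ)) ^ 2) (Measure.pi fun _ => μ) :=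
    fun c => (memLp_add_sum_centered (hcL c) e (v c) r).integrable_sq
  simp_rw [hcoord]
  rw [← ofReal_integral_eq_lintegral_ofReal (integrable_finsetSum _ fun c _ => hint c)
    (.of_forall fun ω => Finset.sum_nonneg fun c _ => sq_nonneg _),
    integral_finsetSum _ fun c _ => hint c]
  refine ENNReal.ofReal_le_ofReal ?_
  calc _ ≤ ∑ c, ((v c) ^ 2 + r ^ 2 * ∑ k, ∫ x, X k x c ^ 2 ∂μ) :=
        Finset.sum_le_sum fun c _ => integral_add_sum_centered_sq_le (hcm c) (hcL c) he _ _
    _ = ‖v‖ ^ 2 + r ^ 2 * ∑ k, ∫ x, ‖X k x‖ ^ 2 ∂μ := by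
        rw [Finset.sum_add_distrib, ← Finset.mul_sum, Finset.sum_comm,
          EuclideanSpace.real_norm_sq_eq]
        congr 3 with k
        rw [← integral_finsetSum _ fun c _ => (hcL c k).integrable_sq]
        simp_rw [EuclideanSpace.real_norm_sq_eq]
    _ ≤ ‖v‖ ^ 2 + r ^ 2 * (Fintype.card κ * M ^ 2) := by
        gcongr
        rw [← nsmul_eq_mul, ← Finset.card_univ]
        refine Finset.sum_le_card_nsmul _ _ _ fun k _ => ?_
        have : ∫ x, ‖X k x‖ ^ 2 ∂μ ≤ ∫ _, M ^ 2 ∂μ := by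
          refine integral_mono_ae ?_ (integrable_const _) ?_
          · exact (MemLp.of_bound (hm k).aestronglyMeasurable M (hX k)).integrable_norm_pow
              two_ne_zero
          · filter_upwards [hX k] with x hx
            gcongr
        simpa using this

end Variance

/-! ### Variance of a batch estimator. -/

section Batch

variable {d : ℕ} [NeZero d]

/-- The mean of `c(u) u` over the sphere is smaller than the crude bound by the factor `√d`. -/
theorem norm_integral_smul_sphere_le {c : Vec d → ℝ} (hc : Measurable c) {κ : ℝ}
    (hb : ∀ u, ‖u‖ = 1 → |c u| ≤ d * κ) :
    ‖∫ u, c u • u ∂uniformSphere d‖ ≤ √d * κ := by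
  have hd : (0 : ℝ) < d := by exact_mod_cast NeZero.pos d
  have hb' : ∀ᵐ u ∂uniformSphere d, |c u| ≤ d * κ :=
    ae_norm_eq_one_uniformSphere.mono hb
  have hκ : 0 ≤ κ := by
    obtain ⟨u, hu⟩ := hb'.exists
    exact nonneg_of_mul_nonneg_right ((abs_nonneg _).trans hu) hd
  have hi : Integrable (fun u => c u • u) (uniformSphere d) := by
    refine Integrable.of_bound (hc.smul measurable_id).aestronglyMeasurable (d * κ) ?_
    filter_upwards [hb', ae_norm_eq_one_uniformSphere] with u hu hu1
    simpa [norm_smul, hu1] using hu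
  set a := ∫ u, c u • u ∂uniformSphere d with ha
  have h1 : ‖a‖ ^ 2 = ∫ u, c u * inner ℝ u a ∂uniformSphere d := by
    rw [← real_inner_self_eq_norm_sq]
    nth_rewrite 2 [ha]
    rw [← integral_inner hi]
    simp_rw [real_inner_smul_right, real_inner_comm]
  have hin : Continuous fun u : Vec d => inner ℝ u a := by fun_prop
  have hci : ∫ u, c u ^ 2 ∂uniformSphere d ≤ (d * κ) ^ 2 := by
    have : ∫ u, c u ^ 2 ∂uniformSphere d ≤ ∫ _, (d * κ) ^ 2 ∂uniformSphere d := by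
      refine integral_mono_ae ?_ (integrable_const _) ?_
      · exact (MemLp.of_bound hc.aestronglyMeasurable _ hb').integrable_sq
      · filter_upwards [hb'] with u hu
        exact sq_le_sq' (abs_le.1 hu).1 (abs_le.1 hu).2
    simpa using this
  -- Young's inequality with the optimal weight
  have h2 : ∀ t : ℝ, 2 * t * ‖a‖ ^ 2 ≤ (d * κ) ^ 2 + t ^ 2 * (‖a‖ ^ 2 / d) := by
    intro t
    have hcs : Integrable (fun u => c u ^ 2) (uniformSphere d) :=
      (MemLp.of_bound hc.aestronglyMeasurable _ hb').integrable_sq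
    have his : Integrable (fun u : Vec d => (inner ℝ u a) ^ 2) (uniformSphere d) :=
      Continuous.integrable_uniformSphere (by fun_prop)
    have hcin : Integrable (fun u => c u * inner ℝ u a) (uniformSphere d) :=
      (Continuous.integrable_uniformSphere hin).bdd_mul hc.aestronglyMeasurable hb'
    rw [← integral_inner_sq_uniformSphere a]
    calc 2 * t * ‖a‖ ^ 2 = ∫ u, 2 * t * (c u * inner ℝ u a) ∂uniformSphere d := by
          rw [integral_const_mul, ← h1]
      _ ≤ ∫ u, (c u ^ 2 + t ^ 2 * (inner ℝ u a) ^ 2) ∂uniformSphere d := by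
          refine integral_mono (hcin.const_mul _) (hcs.add (his.const_mul _)) fun u => ?_
          nlinarith [sq_nonneg (c u - t * inner ℝ u a)]
      _ = ∫ u, c u ^ 2 ∂uniformSphere d + t ^ 2 * ∫ u, (inner ℝ u a) ^ 2 ∂uniformSphere d := by
          rw [integral_add hcs (his.const_mul _), integral_const_mul]
      _ ≤ _ := by gcongr
  -- The value `t = d` maximizes `2t - t²/d`.
  have h3 := h2 d
  have h4 : (d : ℝ) ^ 2 * (‖a‖ ^ 2 / d) = d * ‖a‖ ^ 2 := by field_simp
  rw [h4] at h3
  have h5 : ‖a‖ ^ 2 ≤ d * κ ^ 2 := by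
    have : (d : ℝ) * ‖a‖ ^ 2 ≤ d * (d * κ ^ 2) := by nlinarith
    exact le_of_mul_le_mul_left this hd
  refine abs_le_of_sq_le_sq' ?_ (by positivity) |>.2
  rw [mul_pow, Real.sq_sqrt hd.le]
  exact h5

variable {𝒵 ι κ : Type*} [MeasurableSpace 𝒵] [Fintype ι] [Fintype κ] [Nonempty κ]

/-- The second moment of a batch estimator around its mean, shifted by `v`: for each of the data
points `z (e i)` the summand is an average over `d` directions. -/
theorem lintegral_batch_le (𝒟 : Measure 𝒵) [IsProbabilityMeasure 𝒟] {c : 𝒵 → Vec d → ℝ}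
    (hc : Measurable (Function.uncurry c)) {B : ℝ}
    (hb : ∀ z u, ‖u‖ = 1 → |c z u| ≤ d * B) {e : κ → ι} (he : e.Injective) (v : Vec d) :
    ∫⁻ z : ι → 𝒵, ∫⁻ u : ι × Fin d → Vec d, ENNReal.ofReal
      (‖v + ((1 / (Fintype.card κ : ℝ)) • ∑ i, (1 / (d : ℝ)) • ∑ j,
          c (z (e i)) (u (e i, j)) • u (e i, j)
        - ∫ z, ∫ u, c z u • u ∂uniformSphere d ∂𝒟)‖ ^ 2)
      ∂(Measure.pi fun _ => uniformSphere d) ∂(Measure.pi fun _ => 𝒟)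
    ≤ ENNReal.ofReal (‖v‖ ^ 2 + 2 * d * B ^ 2 / Fintype.card κ) := by
  have hd : (0 : ℝ) < d := by exact_mod_cast NeZero.pos d
  have hk : (0 : ℝ) < Fintype.card κ := by exact_mod_cast Fintype.card_pos
  set a : 𝒵 → Vec d := fun z => ∫ u, c z u • u ∂uniformSphere d with ha
  set m : Vec d := ∫ z, a z ∂𝒟 with hm
  have ham : Measurable a := by
    have h1 : StronglyMeasurable (Function.uncurry fun z (u : Vec d) => c z u • u) :=
      (hc.smul measurable_snd).stronglyMeasurable
    exact h1.integral_prod_right.measurable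
  have hab : ∀ z, ‖a z‖ ≤ √d * B := fun z =>
    norm_integral_smul_sphere_le (hc.comp measurable_prodMk_left) (hb z)
  -- With the data fixed, only the directions are random: the direction averages are centered at `a
  -- (z (e i))`, and the deviation of these means from `m` joins the shift.
  have hinner : ∀ z : ι → 𝒵, ∫⁻ u : ι × Fin d → Vec d, ENNReal.ofReal
      (‖v + ((1 / (Fintype.card κ : ℝ)) • ∑ i, (1 / (d : ℝ)) • ∑ j,
          c (z (e i)) (u (e i, j)) • u (e i, j) - m)‖ ^ 2)
      ∂(Measure.pi fun _ => uniformSphere d) ≤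
      ENNReal.ofReal (‖v + (1 / (Fintype.card κ : ℝ)) • ∑ i, (a (z (e i)) - m)‖ ^ 2) +
        ENNReal.ofReal (d * B ^ 2 / Fintype.card κ) := by
    intro z
    have he' : Function.Injective fun p : κ × Fin d => (e p.1, p.2) := fun p q h => by
      simp only [Prod.mk.injEq] at h
      exact Prod.ext (he h.1) h.2
    have h1 := lintegral_norm_sq_add_sum_centered_le (μ := uniformSphere d) (M := d * B)
      (X := fun (p : κ × Fin d) u => c (z (e p.1)) u • u)
      (fun p => (hc.comp measurable_prodMk_left).smul measurable_id)
      (fun p => by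
        filter_upwards [ae_norm_eq_one_uniformSphere] with u hu
        simpa [norm_smul, hu] using hb (z (e p.1)) u hu) he'
      (v + (1 / (Fintype.card κ : ℝ)) • ∑ i, (a (z (e i)) - m))
      (1 / (Fintype.card κ : ℝ) * (1 / (d : ℝ)))
    rw [ENNReal.ofReal_add (sq_nonneg _) (by positivity)] at h1
    -- With `b = Fintype.card κ`, there are `bd` independent terms of weight `1/(bd)` and norm at
    -- most `dB`.
    have h2 : (1 / (Fintype.card κ : ℝ) * (1 / (d : ℝ))) ^ 2 *
        (Fintype.card (κ × Fin d) * (d * B) ^ 2) = d * B ^ 2 / Fintype.card κ := by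
      rw [Fintype.card_prod, Fintype.card_fin]
      push_cast
      field_simp
    rw [h2] at h1
    refine le_trans (le_of_eq (lintegral_congr fun u => ?_)) h1
    congr 3
    rw [Fintype.sum_prod_type]
    simp only [Finset.sum_sub_distrib, Finset.smul_sum, smul_sub, smul_smul, mul_assoc]
    have h3 : ∀ i : κ, ∑ j : Fin d, (1 / (Fintype.card κ : ℝ) * (1 / (d : ℝ))) •
        ∫ u, c (z (e i)) u • u ∂uniformSphere d = (1 / (Fintype.card κ : ℝ)) • a (z (e i)) := by
      intro i
      rw [Finset.sum_const, Finset.card_univ, Fintype.card_fin, ← Nat.cast_smul_eq_nsmul ℝ,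
        smul_smul]
      congr 1
      field_simp
    have h4 : ∑ _ : κ, (1 / (Fintype.card κ : ℝ)) • m = m := by
      rw [Finset.sum_const, Finset.card_univ, ← Nat.cast_smul_eq_nsmul ℝ, smul_smul,
        mul_one_div_cancel hk.ne', one_smul]
    simp only [h3, h4]
    abel
  refine (lintegral_mono hinner).trans ?_
  rw [lintegral_add_right _ measurable_const, lintegral_const, measure_univ, mul_one]
  -- Now the data are averaged, with the sharper bound `√d B` for the means; this gives the second
  -- `dB²/b`.
  have h5 := lintegral_norm_sq_add_sum_centered_le (μ := 𝒟) (X := fun (_ : κ) z => a z)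
    (fun _ => ham) (fun _ => .of_forall hab) he v (1 / (Fintype.card κ : ℝ))
  refine (add_le_add_left h5 _).trans ?_
  rw [← ENNReal.ofReal_add (by positivity) (by positivity)]
  refine ENNReal.ofReal_le_ofReal (le_of_eq ?_)
  rw [mul_pow, Real.sq_sqrt hd.le]
  field_simp
  ring

end Batch

/-! ### Unbiasedness and variance of the two zeroth-order estimators. -/

section Estimators

variable {d : ℕ} {𝒵 : Type*} [MeasurableSpace 𝒵]

theorem lipschitzWith_objective {𝒟 : Measure 𝒵} [IsProbabilityMeasure 𝒟] {f : Vec d → 𝒵 → ℝ}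
    {L : NNReal} (hf_int : ∀ x, Integrable (f x) 𝒟)
    (hf_lip : ∀ z, LipschitzWith L fun x => f x z) : LipschitzWith L (objective 𝒟 f) := by
  refine LipschitzWith.of_dist_le_mul fun x y => ?_
  rw [Real.dist_eq, objective, objective, ← integral_sub (hf_int x) (hf_int y),
    ← Real.norm_eq_abs]
  refine (norm_integral_le_of_norm_le_const (C := L * dist x y) (.of_forall fun z => ?_)).trans_eq
    (by simp)
  exact (hf_lip z).dist_le_mul x y

theorem measurable_uncurry_of_lipschitz {f : Vec d → 𝒵 → ℝ} {L : NNReal}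
    (hf_meas : ∀ x, Measurable (f x)) (hf_lip : ∀ z, LipschitzWith L fun x => f x z) :
    Measurable (Function.uncurry f) :=
  measurable_uncurry_of_continuous_of_measurable (fun z => (hf_lip z).continuous) hf_meas

variable [NeZero d]

/-- By Fubini the data average can be taken inside, which turns differences of `f` into differences
of `objective` and so identifies the estimators' means. -/
theorem integral_integral_smul_sphere {𝒟 : Measure 𝒵} [IsProbabilityMeasure 𝒟]
    {c : 𝒵 → Vec d → ℝ} (hc : Measurable (Function.uncurry c)) {B : ℝ}
    (hb : ∀ z u, ‖u‖ = 1 → |c z u| ≤ B) :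
    ∫ z, ∫ u, c z u • u ∂uniformSphere d ∂𝒟 =
      ∫ u, (∫ z, c z u ∂𝒟) • u ∂uniformSphere d := by
  have hi : Integrable (Function.uncurry fun z (u : Vec d) => c z u • u)
      (𝒟.prod (uniformSphere d)) := by
    refine Integrable.of_bound (hc.smul measurable_snd).aestronglyMeasurable B ?_
    have := Measure.quasiMeasurePreserving_snd (μ := 𝒟) (ν := uniformSphere d) |>.ae
      ae_norm_eq_one_uniformSphere
    filter_upwards [this] with p hp
    simpa [Function.uncurry, norm_smul, hp] using hb p.1 p.2 hp
  rw [integral_integral_swap hi]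
  simp_rw [integral_smul_const]

variable {ι : Type*} [Fintype ι] {𝒟 : Measure 𝒵} [IsProbabilityMeasure 𝒟] {f : Vec d → 𝒵 → ℝ}
  {L : NNReal} {δ : ℝ} {b : ℕ} {e : Fin b → ι}

/-- The points `x ± δu` are `2δ` apart, so the weights are at most `dL`: the batch bound applies
with `B = L` and zero shift. -/
theorem lintegral_gradEst_le (hδ : 0 < δ) (hf_meas : ∀ x, Measurable (f x))
    (hf_int : ∀ x, Integrable (f x) 𝒟) (hf_lip : ∀ z, LipschitzWith L fun x => f x z)
    (hb : 1 ≤ b) (he : e.Injective) (x : Vec d) :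
    ∫⁻ z : ι → 𝒵, ∫⁻ u : ι × Fin d → Vec d, ENNReal.ofReal
      (‖gradEst f δ x (fun i => z (e i)) (fun i j => u (e i, j))
        - gradient (smoothing δ (objective 𝒟 f)) x‖ ^ 2)
      ∂(Measure.pi fun _ => uniformSphere d) ∂(Measure.pi fun _ => 𝒟)
    ≤ ENNReal.ofReal (2 * d * L ^ 2 / b) := by
  have : Nonempty (Fin b) := ⟨⟨0, hb⟩⟩
  set c : 𝒵 → Vec d → ℝ := fun z u =>
    (d : ℝ) / (2 * δ) * (f (x + δ • u) z - f (x - δ • u) z) with hcdef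
  have hfm := measurable_uncurry_of_lipschitz hf_meas hf_lip
  have hc : Measurable (Function.uncurry c) := by
    have h1 : Measurable fun p : 𝒵 × Vec d => f (x + δ • p.2) p.1 :=
      hfm.comp (by fun_prop : Measurable fun p : 𝒵 × Vec d => (x + δ • p.2, p.1))
    have h2 : Measurable fun p : 𝒵 × Vec d => f (x - δ • p.2) p.1 :=
      hfm.comp (by fun_prop : Measurable fun p : 𝒵 × Vec d => (x - δ • p.2, p.1))
    exact (h1.sub h2).const_mul _
  have hcb : ∀ z u, ‖u‖ = 1 → |c z u| ≤ d * (L : ℝ) := by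
    intro z u hu
    have h := (hf_lip z).dist_le_mul (x + δ • u) (x - δ • u)
    have h1 : dist (x + δ • u) (x - δ • u) = 2 * δ := by
      rw [dist_eq_norm, add_sub_sub_cancel, ← two_smul ℝ, smul_smul, norm_smul, hu,
        Real.norm_of_nonneg (by positivity), mul_one]
    rw [h1, Real.dist_eq] at h
    rw [hcdef, abs_mul, abs_of_nonneg (by positivity)]
    calc (d : ℝ) / (2 * δ) * |f (x + δ • u) z - f (x - δ • u) z|
        ≤ d / (2 * δ) * (L * (2 * δ)) := by gcongr
      _ = d * L := by field_simp
  have hmean : ∫ z, ∫ u, c z u • u ∂uniformSphere d ∂𝒟 =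
      gradient (smoothing δ (objective 𝒟 f)) x := by
    rw [integral_integral_smul_sphere hc hcb,
      gradient_smoothing_symm (lipschitzWith_objective hf_int hf_lip) hδ.ne']
    simp only [hcdef, objective, integral_const_mul, integral_sub (hf_int _) (hf_int _)]
  have h := lintegral_batch_le 𝒟 hc hcb he 0
  rw [hmean] at h
  simpa [gradEst, hcdef] using h

/-- Both evaluations share the direction `u`, so the weights scale with `‖x - y‖`. The shift `v`
will be the error of the preceding round. -/
theorem lintegral_diffEst_le (hδ : 0 < δ) (hf_meas : ∀ x, Measurable (f x))
    (hf_int : ∀ x, Integrable (f x) 𝒟) (hf_lip : ∀ z, LipschitzWith L fun x => f x z)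
    (hb : 1 ≤ b) (he : e.Injective) (v x y : Vec d) :
    ∫⁻ z : ι → 𝒵, ∫⁻ u : ι × Fin d → Vec d, ENNReal.ofReal
      (‖v + (diffEst f δ x y (fun i => z (e i)) (fun i j => u (e i, j))
        - (gradient (smoothing δ (objective 𝒟 f)) x
          - gradient (smoothing δ (objective 𝒟 f)) y))‖ ^ 2)
      ∂(Measure.pi fun _ => uniformSphere d) ∂(Measure.pi fun _ => 𝒟)
    ≤ ENNReal.ofReal (‖v‖ ^ 2 + 2 * d * (L * ‖x - y‖ / δ) ^ 2 / b) := by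
  have : Nonempty (Fin b) := ⟨⟨0, hb⟩⟩
  set c : 𝒵 → Vec d → ℝ := fun z u =>
    (d : ℝ) / δ * (f (x + δ • u) z - f (y + δ • u) z) with hcdef
  have hfm := measurable_uncurry_of_lipschitz hf_meas hf_lip
  have hc : Measurable (Function.uncurry c) := by
    have h1 : ∀ x, Measurable fun p : 𝒵 × Vec d => f (x + δ • p.2) p.1 := fun x =>
      hfm.comp (by fun_prop : Measurable fun p : 𝒵 × Vec d => (x + δ • p.2, p.1))
    exact ((h1 x).sub (h1 y)).const_mul _
  have hcb : ∀ z u, ‖u‖ = 1 → |c z u| ≤ d * (L * ‖x - y‖ / δ) := by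
    intro z u _
    have h := (hf_lip z).dist_le_mul (x + δ • u) (y + δ • u)
    rw [dist_add_right, dist_eq_norm x y, Real.dist_eq] at h
    rw [hcdef, abs_mul, abs_of_nonneg (by positivity)]
    calc (d : ℝ) / δ * |f (x + δ • u) z - f (y + δ • u) z| ≤ d / δ * (L * ‖x - y‖) := by gcongr
      _ = d * (L * ‖x - y‖ / δ) := by ring
  have hF := lipschitzWith_objective hf_int hf_lip
  have hmean : ∫ z, ∫ u, c z u • u ∂uniformSphere d ∂𝒟 =
      gradient (smoothing δ (objective 𝒟 f)) x - gradient (smoothing δ (objective 𝒟 f)) y := by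
    have hi : ∀ x, Integrable (fun u => objective 𝒟 f (x + δ • u) • u) (uniformSphere d) :=
      fun x => Continuous.integrable_uniformSphere
        ((hF.continuous.comp (by fun_prop)).smul continuous_id)
    rw [integral_integral_smul_sphere hc hcb, gradient_smoothing hF hδ.ne',
      gradient_smoothing hF hδ.ne', ← smul_sub, ← integral_sub (hi x) (hi y), ← integral_smul]
    simp only [hcdef, integral_const_mul, integral_sub (hf_int _) (hf_int _), mul_smul, sub_smul]
    rfl
  have h := lintegral_batch_le 𝒟 hc hcb he v
  rw [hmean] at h
  simpa [diffEst, hcdef] using h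

end Estimators

/-! ### Resampling a block of independent coordinates. -/

section Resampling

variable {ι α : Type*} [MeasurableSpace α]

/-- The family that agrees with `y` at the indices in `p` and with `x` elsewhere. -/
def mix (p : ι → Prop) [DecidablePred p] (x y : ι → α) : ι → α := fun i => if p i then y i else x i

variable (p : ι → Prop) [DecidablePred p]

theorem measurable_mix : Measurable fun q : (ι → α) × (ι → α) => mix p q.1 q.2 := by
  refine measurable_pi_iff.2 fun i => ?_
  by_cases h : p i
  · simp only [mix, h, if_true]; fun_prop
  · simp only [mix, h, if_false]; fun_prop

variable [Fintype ι]

/-- Replacing a block of independent coordinates by an independent copy preserves the law. -/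
theorem measurePreserving_mix (μ : Measure α) [IsProbabilityMeasure μ] :
    MeasurePreserving (fun q : (ι → α) × (ι → α) => mix p q.1 q.2)
      ((Measure.pi fun _ => μ).prod (Measure.pi fun _ => μ)) (Measure.pi fun _ => μ) := by
  refine ⟨measurable_mix p, (Measure.pi_eq fun s hs => ?_).symm⟩
  rw [Measure.map_apply (measurable_mix p) (.univ_pi hs)]
  have : (fun q : (ι → α) × (ι → α) => mix p q.1 q.2) ⁻¹' Set.univ.pi s =
      (Set.univ.pi fun i => if p i then Set.univ else s i) ×ˢ
        (Set.univ.pi fun i => if p i then s i else Set.univ) := by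
    ext ⟨x, y⟩
    simp only [Set.mem_preimage, Set.mem_univ_pi, Set.mem_prod, ← forall_and]
    refine forall_congr' fun i => ?_
    by_cases h : p i <;> simp [mix, h]
  rw [this, Measure.prod_prod, Measure.pi_pi, Measure.pi_pi, ← Finset.prod_mul_distrib]
  refine Finset.prod_congr rfl fun i _ => ?_
  by_cases h : p i <;> simp [h]

variable {β : Type*} [MeasurableSpace β]

theorem lintegral_prod_mix (μ : Measure α) [IsProbabilityMeasure μ] (ν : Measure β) [SFinite ν]
    {φ : (ι → α) × β → ENNReal} (hφ : Measurable φ) :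
    ∫⁻ s, φ s ∂((Measure.pi fun _ => μ).prod ν) =
      ∫⁻ s, ∫⁻ x', φ (mix p s.1 x', s.2) ∂(Measure.pi fun _ => μ)
        ∂((Measure.pi fun _ => μ).prod ν) := by
  have hm : Measurable fun q : ((ι → α) × β) × (ι → α) => φ (mix p q.1.1 q.2, q.1.2) :=
    hφ.comp (((measurable_mix p).comp
      (by fun_prop : Measurable fun q : ((ι → α) × β) × (ι → α) => (q.1.1, q.2))).prodMk
        (by fun_prop))
  have hm2 : Measurable fun q : (ι → α) × (ι → α) => ∫⁻ y, φ (mix p q.1 q.2, y) ∂ν := by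
    refine Measurable.lintegral_prod_right' (f := fun r : ((ι → α) × (ι → α)) × β =>
      φ (mix p r.1.1 r.1.2, r.2)) ?_
    exact hφ.comp (((measurable_mix p).comp measurable_fst).prodMk measurable_snd)
  rw [lintegral_prod _ hφ.aemeasurable, lintegral_prod _ (hm.lintegral_prod_right').aemeasurable,
    ← (measurePreserving_mix p μ).lintegral_comp hφ.lintegral_prod_right',
    lintegral_prod _ hm2.aemeasurable]
  refine lintegral_congr fun x => ?_
  refine lintegral_lintegral_swap (f := fun x' y => φ (mix p x x', y)) ?_
  exact (hφ.comp (((measurable_mix p).comp (measurable_const.prodMk measurable_fst)).prodMk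
    measurable_snd)).aemeasurable

/-- Applied with the data and the directions of one round as the two blocks, this replaces
conditioning on everything else by an iterated integral. -/
theorem lintegral_prod_prod_mix {κ γ : Type*} [Fintype κ] [MeasurableSpace γ] (q : κ → Prop)
    [DecidablePred q] (μ : Measure α) [IsProbabilityMeasure μ] (μ' : Measure γ)
    [IsProbabilityMeasure μ'] (ν : Measure β) [SFinite ν]
    {φ : (ι → α) × (κ → γ) × β → ENNReal} (hφ : Measurable φ) :
    ∫⁻ s, φ s ∂((Measure.pi fun _ => μ).prod ((Measure.pi fun _ => μ').prod ν)) =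
      ∫⁻ s, ∫⁻ x', ∫⁻ y', φ (mix p s.1 x', mix q s.2.1 y', s.2.2) ∂(Measure.pi fun _ => μ')
        ∂(Measure.pi fun _ => μ)
        ∂((Measure.pi fun _ => μ).prod ((Measure.pi fun _ => μ').prod ν)) := by
  set Φ : (ι → α) × (κ → γ) × β → ENNReal := fun s =>
    ∫⁻ y', φ (s.1, mix q s.2.1 y', s.2.2) ∂(Measure.pi fun _ => μ') with hΦ
  have hΦm : Measurable Φ := by
    refine Measurable.lintegral_prod_right' (f := fun r : ((ι → α) × (κ → γ) × β) × (κ → γ) =>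
      φ (r.1.1, mix q r.1.2.1 r.2, r.1.2.2)) ?_
    have hmix : Measurable fun r : ((ι → α) × (κ → γ) × β) × (κ → γ) => mix q r.1.2.1 r.2 :=
      (measurable_mix q).comp (measurable_fst.snd.fst.prodMk measurable_snd)
    exact hφ.comp (measurable_fst.fst.prodMk (hmix.prodMk measurable_fst.snd.snd))
  rw [← lintegral_prod_mix p μ _ hΦm, lintegral_prod _ hφ.aemeasurable,
    lintegral_prod _ hΦm.aemeasurable]
  refine lintegral_congr fun x => ?_
  exact lintegral_prod_mix q μ' ν (hφ.comp measurable_prodMk_left)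

end Resampling

/-! ### Indices of the tree noise. -/

section Node

theorem nodeStep_invariant {t m : ℕ} (st : ℕ × Finset (ℕ × ℕ)) (i : ℕ)
    (h : ∀ p ∈ st.2, p.2 ∈ Finset.Icc 1 t) :
    ∀ p ∈ (nodeStep t m st i).2, p.2 ∈ Finset.Icc 1 t := by
  unfold nodeStep
  split_ifs with hc
  · intro p hp
    rcases Finset.mem_insert.1 hp with rfl | hp
    · have : 0 < 2 ^ (m - i) := by positivity
      exact Finset.mem_Icc.2 ⟨by simp only; omega, hc.2⟩
    · exact h p hp
  · exact h

/-- Hence the tree value of a round reads no noise beyond that round, and none outside the sample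
space. The invariant is carried through the fold from an arbitrary state. -/
theorem snd_mem_Icc_of_mem_node {t : ℕ} {p : ℕ × ℕ} (hp : p ∈ node t) :
    p.2 ∈ Finset.Icc 1 t := by
  have key : ∀ (l : List ℕ) (st : ℕ × Finset (ℕ × ℕ)), (∀ p ∈ st.2, p.2 ∈ Finset.Icc 1 t) →
      ∀ p ∈ (l.foldl (nodeStep t (Nat.clog 2 t)) st).2, p.2 ∈ Finset.Icc 1 t := by
    intro l
    induction l with
    | nil => exact fun st h => h
    | cons i l ih => exact fun st h => ih _ (nodeStep_invariant st i h)
  exact key _ (0, ∅) (by simp) p hp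

theorem tree_congr {d : ℕ} {ξ ξ' : ℕ → Vec d} {t : ℕ} (h : ∀ b ∈ Finset.Icc 1 t, ξ b = ξ' b) :
    tree ξ t = tree ξ' t :=
  Finset.sum_congr rfl fun _ hp => h _ (snd_mem_Icc_of_mem_node hp)

end Node

/-! ### Causality: which randomness a run reads. -/

section Congr

variable {d : ℕ} {𝒵 R : Type*}

/-- Two realizations agree on the part used in `K` epochs of `T` rounds, except possibly for the
data and the directions of the rounds outside `S`. -/
structure AgreeOn (K T B₁ B₂ : ℕ) (S : ℕ → ℕ → Prop) (ρ ρ' : Randomness d 𝒵 R) : Prop where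
  z : ∀ k ∈ Finset.Icc 1 K, ∀ t ∈ Finset.Icc 1 T, S k t → ∀ i < batchSize B₁ B₂ t,
    ρ.z k t i = ρ'.z k t i
  u : ∀ k ∈ Finset.Icc 1 K, ∀ t ∈ Finset.Icc 1 T, S k t → ∀ i < batchSize B₁ B₂ t,
    ρ.u k t i = ρ'.u k t i
  s : ∀ k ∈ Finset.Icc 1 K, ∀ t ∈ Finset.Icc 1 T, ρ.s k t = ρ'.s k t
  ξ : ∀ k ∈ Finset.Icc 1 K, ∀ t ∈ Finset.Icc 1 T, ρ.ξ k t = ρ'.ξ k t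
  r : ∀ k ∈ Finset.Icc 1 K, ρ.r k = ρ'.r k

variable [MeasurableSpace R] {f : Vec d → 𝒵 → ℝ} {δ : ℝ} {K T B₁ B₂ : ℕ} {A : OCOAlgorithm d R}
  {S : ℕ → ℕ → Prop} {ρ ρ' : Randomness d 𝒵 R} {k : ℕ}

theorem AgreeOn.epoch_eq (h : AgreeOn K T B₁ B₂ S ρ ρ') (hk : k ∈ Finset.Icc 1 K) (x : Vec d)
    {n : ℕ} (hn : n ≤ T) (hS : ∀ t ∈ Finset.Icc 1 n, S k t) :
    epoch f δ B₁ B₂ A ρ k x n = epoch f δ B₁ B₂ A ρ' k x n := by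
  induction n with
  | zero => rfl
  | succ n ih =>
    have ih := ih (by omega) fun t ht => hS t (by simp only [Finset.mem_Icc] at ht ⊢; omega)
    have hmem : n + 1 ∈ Finset.Icc 1 T := by simp only [Finset.mem_Icc]; omega
    have hSn : S k (n + 1) := hS _ (by simp)
    have htree : tree (ρ.ξ k) (n + 1) = tree (ρ'.ξ k) (n + 1) :=
      tree_congr fun b hb => h.ξ k hk b (by simp only [Finset.mem_Icc] at hb ⊢; omega)
    simp only [epoch, ih, h.s k hk _ hmem, h.r k hk, htree]
    rcases Nat.eq_zero_or_pos n with rfl | hpos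
    · have hz : (fun i : Fin B₁ => ρ.z k 1 i) = fun i : Fin B₁ => ρ'.z k 1 i :=
        funext fun i => h.z k hk 1 hmem hSn i (by simp [batchSize])
      have hu : (fun i : Fin B₁ => ρ.u k 1 i) = fun i : Fin B₁ => ρ'.u k 1 i :=
        funext fun i => h.u k hk 1 hmem hSn i (by simp [batchSize])
      simp only [hz, hu, if_true]
    · have hz : (fun i : Fin B₂ => ρ.z k (n + 1) i) = fun i : Fin B₂ => ρ'.z k (n + 1) i :=
        funext fun i => h.z k hk _ hmem hSn i (by simp [batchSize, hpos.ne'])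
      have hu : (fun i : Fin B₂ => ρ.u k (n + 1) i) = fun i : Fin B₂ => ρ'.u k (n + 1) i :=
        funext fun i => h.u k hk _ hmem hSn i (by simp [batchSize, hpos.ne'])
      simp only [hz, hu, hpos.ne', if_false]

/-- The query point of round `n + 1` is chosen before its batch is read, so agreement of the batches
is needed only up to round `n`. -/
theorem AgreeOn.epoch_w_eq (h : AgreeOn K T B₁ B₂ S ρ ρ') (hk : k ∈ Finset.Icc 1 K) (x : Vec d)
    {n : ℕ} (hn : n + 1 ≤ T) (hS : ∀ t ∈ Finset.Icc 1 n, S k t) :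
    (epoch f δ B₁ B₂ A ρ k x (n + 1)).w = (epoch f δ B₁ B₂ A ρ' k x (n + 1)).w := by
  have hmem : n + 1 ∈ Finset.Icc 1 T := by simp only [Finset.mem_Icc]; omega
  simp only [epoch, h.epoch_eq hk x (by omega : n ≤ T) hS, h.s k hk _ hmem, h.r k hk]

theorem AgreeOn.epochStart_eq (h : AgreeOn K T B₁ B₂ S ρ ρ') (x₁ : Vec d) {m : ℕ} (hm : m ≤ K)
    (hS : ∀ k ∈ Finset.Icc 1 m, ∀ t ∈ Finset.Icc 1 T, S k t) :
    epochStart f δ T B₁ B₂ A x₁ ρ m = epochStart f δ T B₁ B₂ A x₁ ρ' m := by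
  induction m with
  | zero => rfl
  | succ m ih =>
    have ih := ih (by omega) fun k hk => hS k (by simp only [Finset.mem_Icc] at hk ⊢; omega)
    rw [epochStart, epochStart, ih, h.epoch_eq (by simp only [Finset.mem_Icc]; omega) _ le_rfl
      (hS (m + 1) (by simp))]

end Congr

/-! ### Measurability of the run. -/

section Measurability

variable {d : ℕ} {𝒵 R Ω : Type*} [MeasurableSpace 𝒵] [MeasurableSpace R] [MeasurableSpace Ω]

/-- All components of a random realization are measurable. -/
structure MeasurableRandomness (ρ : Ω → Randomness d 𝒵 R) : Prop where
  z : ∀ k t i, Measurable fun ω => (ρ ω).z k t i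
  u : ∀ k t i j, Measurable fun ω => (ρ ω).u k t i j
  s : ∀ k t, Measurable fun ω => (ρ ω).s k t
  ξ : ∀ k t, Measurable fun ω => (ρ ω).ξ k t
  r : ∀ k, Measurable fun ω => (ρ ω).r k

variable {f : Vec d → 𝒵 → ℝ} {δ : ℝ} {b : ℕ}

theorem measurable_gradEst (hf : Measurable (Function.uncurry f)) {x : Ω → Vec d}
    (hx : Measurable x) {z : Ω → Fin b → 𝒵} (hz : ∀ i, Measurable fun ω => z ω i)
    {u : Ω → Fin b → Fin d → Vec d} (hu : ∀ i j, Measurable fun ω => u ω i j) :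
    Measurable fun ω => gradEst f δ (x ω) (z ω) (u ω) := by
  have h1 : ∀ i j, Measurable fun ω => f (x ω + δ • u ω i j) (z ω i) := fun i j =>
    hf.comp ((hx.add ((hu i j).const_smul δ)).prodMk (hz i))
  have h2 : ∀ i j, Measurable fun ω => f (x ω - δ • u ω i j) (z ω i) := fun i j =>
    hf.comp ((hx.sub ((hu i j).const_smul δ)).prodMk (hz i))
  unfold gradEst
  fun_prop

theorem measurable_diffEst (hf : Measurable (Function.uncurry f)) {x y : Ω → Vec d}
    (hx : Measurable x) (hy : Measurable y) {z : Ω → Fin b → 𝒵}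
    (hz : ∀ i, Measurable fun ω => z ω i)
    {u : Ω → Fin b → Fin d → Vec d} (hu : ∀ i j, Measurable fun ω => u ω i j) :
    Measurable fun ω => diffEst f δ (x ω) (y ω) (z ω) (u ω) := by
  have h1 : ∀ i j, Measurable fun ω => f (x ω + δ • u ω i j) (z ω i) := fun i j =>
    hf.comp ((hx.add ((hu i j).const_smul δ)).prodMk (hz i))
  have h2 : ∀ i j, Measurable fun ω => f (y ω + δ • u ω i j) (z ω i) := fun i j =>
    hf.comp ((hy.add ((hu i j).const_smul δ)).prodMk (hz i))
  unfold diffEst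
  fun_prop

variable {ρ : Ω → Randomness d 𝒵 R}

theorem measurable_epoch (hf : Measurable (Function.uncurry f)) (B₁ B₂ : ℕ)
    (A : OCOAlgorithm d R) (hρ : MeasurableRandomness ρ) (k : ℕ) {x : Ω → Vec d}
    (hx : Measurable x) (n : ℕ) :
    (Measurable fun ω => (epoch f δ B₁ B₂ A (ρ ω) k (x ω) n).x) ∧
    (Measurable fun ω => (epoch f δ B₁ B₂ A (ρ ω) k (x ω) n).w) ∧
    (Measurable fun ω => (epoch f δ B₁ B₂ A (ρ ω) k (x ω) n).g) ∧
    (Measurable fun ω => (epoch f δ B₁ B₂ A (ρ ω) k (x ω) n).feedback) := by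
  induction n with
  | zero => exact ⟨hx, measurable_const, measurable_const, measurable_const⟩
  | succ n ih =>
    obtain ⟨ihx, ihw, ihg, ihf⟩ := ih
    have hΔ : Measurable fun ω =>
        A.act n ((ρ ω).r k) (epoch f δ B₁ B₂ A (ρ ω) k (x ω) n).feedback :=
      (A.measurable_act n).comp ((hρ.r k).prodMk ihf)
    have hw : Measurable fun ω => (epoch f δ B₁ B₂ A (ρ ω) k (x ω) (n + 1)).w :=
      ihx.add ((hρ.s k (n + 1)).smul hΔ)
    have hg : Measurable fun ω => (epoch f δ B₁ B₂ A (ρ ω) k (x ω) (n + 1)).g := by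
      rcases Nat.eq_zero_or_pos n with rfl | hpos
      · exact measurable_gradEst hf hw (fun i => hρ.z k 1 i) (fun i j => hρ.u k 1 i j)
      · have h := ihg.add (measurable_diffEst (δ := δ) hf hw ihw
          (fun i : Fin B₂ => hρ.z k (n + 1) i) (fun i j => hρ.u k (n + 1) i j))
        convert h using 2 with ω
        conv_lhs => rw [epoch]
        simp only [hpos.ne', if_false]
        rfl
    have htree : Measurable fun ω => tree ((ρ ω).ξ k) (n + 1) :=
      Finset.measurable_fun_sum _ fun p _ => hρ.ξ k p.2
    refine ⟨ihx.add hΔ, hw, hg, measurable_pi_iff.2 fun i => ?_⟩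
    refine Fin.lastCases ?_ (fun i => ?_) i
    · have : Measurable fun ω => (epoch f δ B₁ B₂ A (ρ ω) k (x ω) (n + 1)).g +
          tree ((ρ ω).ξ k) (n + 1) := hg.add htree
      convert this using 2 with ω
      simp only [epoch, Fin.snoc_last]
    · have := measurable_pi_iff.1 ihf i
      convert this using 2 with ω
      simp only [epoch, Fin.snoc_castSucc]

theorem measurable_epochStart (hf : Measurable (Function.uncurry f)) (T B₁ B₂ : ℕ)
    (A : OCOAlgorithm d R) (hρ : MeasurableRandomness ρ) (x₁ : Vec d) (m : ℕ) :
    Measurable fun ω => epochStart f δ T B₁ B₂ A x₁ (ρ ω) m := by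
  induction m with
  | zero => exact measurable_const
  | succ m ih => exact (measurable_epoch hf B₁ B₂ A hρ (m + 1) ih T).1

end Measurability

/-! ### The canonical sample space and batch replacement. -/

section OfSample

variable {d K T B₁ B₂ : ℕ} {𝒵 R : Type*}

open Classical in
/-- A realization whose used part is the given sample. -/
def ofSample [Nonempty 𝒵] [Nonempty R] (s : SampleSpace K T B₁ B₂ d 𝒵 R) : Randomness d 𝒵 R where
  z k t i := if h : (k ∈ Finset.Icc 1 K ∧ t ∈ Finset.Icc 1 T) ∧ i < batchSize B₁ B₂ t then
    s.1 ⟨(⟨k, h.1.1⟩, ⟨t, h.1.2⟩), ⟨i, h.2⟩⟩ else Classical.arbitrary 𝒵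
  u k t i j := if h : (k ∈ Finset.Icc 1 K ∧ t ∈ Finset.Icc 1 T) ∧ i < batchSize B₁ B₂ t then
    s.2.1 (⟨(⟨k, h.1.1⟩, ⟨t, h.1.2⟩), ⟨i, h.2⟩⟩, j) else 0
  s k t := if h : k ∈ Finset.Icc 1 K ∧ t ∈ Finset.Icc 1 T then
    s.2.2.1 (⟨k, h.1⟩, ⟨t, h.2⟩) else 0
  ξ k t := if h : k ∈ Finset.Icc 1 K ∧ t ∈ Finset.Icc 1 T then
    s.2.2.2.1 (⟨k, h.1⟩, ⟨t, h.2⟩) else 0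
  r k := if h : k ∈ Finset.Icc 1 K then s.2.2.2.2 ⟨k, h⟩ else Classical.arbitrary R

variable [Nonempty 𝒵] [Nonempty R]

theorem ofSample_z (s : SampleSpace K T B₁ B₂ d 𝒵 R) {k t i : ℕ} (hk : k ∈ Finset.Icc 1 K)
    (ht : t ∈ Finset.Icc 1 T) (hi : i < batchSize B₁ B₂ t) :
    (ofSample s).z k t i = s.1 ⟨(⟨k, hk⟩, ⟨t, ht⟩), ⟨i, hi⟩⟩ :=
  dif_pos ⟨⟨hk, ht⟩, hi⟩

theorem ofSample_u (s : SampleSpace K T B₁ B₂ d 𝒵 R) {k t i : ℕ} (hk : k ∈ Finset.Icc 1 K)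
    (ht : t ∈ Finset.Icc 1 T) (hi : i < batchSize B₁ B₂ t) :
    (ofSample s).u k t i = fun j => s.2.1 (⟨(⟨k, hk⟩, ⟨t, ht⟩), ⟨i, hi⟩⟩, j) :=
  funext fun _ => dif_pos ⟨⟨hk, ht⟩, hi⟩

theorem ofSample_s (s : SampleSpace K T B₁ B₂ d 𝒵 R) {k t : ℕ} (hk : k ∈ Finset.Icc 1 K)
    (ht : t ∈ Finset.Icc 1 T) : (ofSample s).s k t = s.2.2.1 (⟨k, hk⟩, ⟨t, ht⟩) :=
  dif_pos ⟨hk, ht⟩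

theorem ofSample_ξ (s : SampleSpace K T B₁ B₂ d 𝒵 R) {k t : ℕ} (hk : k ∈ Finset.Icc 1 K)
    (ht : t ∈ Finset.Icc 1 T) : (ofSample s).ξ k t = s.2.2.2.1 (⟨k, hk⟩, ⟨t, ht⟩) :=
  dif_pos ⟨hk, ht⟩

theorem ofSample_r (s : SampleSpace K T B₁ B₂ d 𝒵 R) {k : ℕ} (hk : k ∈ Finset.Icc 1 K) :
    (ofSample s).r k = s.2.2.2.2 ⟨k, hk⟩ :=
  dif_pos hk

/-- The default values in `ofSample` lie outside the used range, so a run on an arbitrary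
probability space is a function of its used sample. -/
theorem agreeOn_ofSample_used (ρ : Randomness d 𝒵 R) :
    AgreeOn K T B₁ B₂ (fun _ _ => True) ρ (ofSample (ρ.used K T B₁ B₂)) where
  z _ hk _ ht _ _ hi := (ofSample_z (ρ.used K T B₁ B₂) hk ht hi).symm
  u _ hk _ ht _ _ hi := (ofSample_u (ρ.used K T B₁ B₂) hk ht hi).symm
  s _ hk _ ht := (ofSample_s (ρ.used K T B₁ B₂) hk ht).symm
  ξ _ hk _ ht := (ofSample_ξ (ρ.used K T B₁ B₂) hk ht).symm
  r _ hk := (ofSample_r (ρ.used K T B₁ B₂) hk).symm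

/-- The sample in which data and directions of the round `p` are replaced. -/
def replaceBatch (p : Round K T) (s : SampleSpace K T B₁ B₂ d 𝒵 R)
    (z : DataIndex K T B₁ B₂ → 𝒵) (u : DataIndex K T B₁ B₂ × Fin d → Vec d) :
    SampleSpace K T B₁ B₂ d 𝒵 R :=
  (mix (fun q => q.1 = p) s.1 z, mix (fun q => q.1.1 = p) s.2.1 u, s.2.2)

theorem agreeOn_replaceBatch (p : Round K T) (s : SampleSpace K T B₁ B₂ d 𝒵 R)
    (z : DataIndex K T B₁ B₂ → 𝒵) (u : DataIndex K T B₁ B₂ × Fin d → Vec d) :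
    AgreeOn K T B₁ B₂ (fun k t => ¬(k = p.1 ∧ t = p.2))
      (ofSample (replaceBatch p s z u)) (ofSample s) where
  z k hk t ht hS i hi := by
    rw [ofSample_z _ hk ht hi, ofSample_z _ hk ht hi]
    refine if_neg fun h => hS ?_
    simp [← h]
  u k hk t ht hS i hi := by
    rw [ofSample_u _ hk ht hi, ofSample_u _ hk ht hi]
    refine funext fun j => if_neg fun h => hS ?_
    simp [← h]
  s k hk t ht := by rw [ofSample_s _ hk ht, ofSample_s _ hk ht]; rfl
  ξ k hk t ht := by rw [ofSample_ξ _ hk ht, ofSample_ξ _ hk ht]; rfl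
  r k hk := by rw [ofSample_r _ hk, ofSample_r _ hk]; rfl

theorem ofSample_replaceBatch_z (p : Round K T) (s : SampleSpace K T B₁ B₂ d 𝒵 R)
    (z : DataIndex K T B₁ B₂ → 𝒵) (u : DataIndex K T B₁ B₂ × Fin d → Vec d) {i : ℕ}
    (hi : i < batchSize B₁ B₂ p.2) :
    (ofSample (replaceBatch p s z u)).z p.1 p.2 i = z ⟨p, ⟨i, hi⟩⟩ := by
  rw [ofSample_z _ p.1.2 p.2.2 hi]
  exact if_pos rfl

theorem ofSample_replaceBatch_u (p : Round K T) (s : SampleSpace K T B₁ B₂ d 𝒵 R)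
    (z : DataIndex K T B₁ B₂ → 𝒵) (u : DataIndex K T B₁ B₂ × Fin d → Vec d) {i : ℕ}
    (hi : i < batchSize B₁ B₂ p.2) :
    (ofSample (replaceBatch p s z u)).u p.1 p.2 i = fun j => u (⟨p, ⟨i, hi⟩⟩, j) := by
  rw [ofSample_u _ p.1.2 p.2.2 hi]
  exact funext fun j => if_pos rfl

theorem measurableRandomness_ofSample [MeasurableSpace 𝒵] [MeasurableSpace R] :
    MeasurableRandomness (ofSample (K := K) (T := T) (B₁ := B₁) (B₂ := B₂) (d := d) (𝒵 := 𝒵)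
      (R := R)) where
  z k t i := by unfold ofSample; simp only; split_ifs <;> fun_prop
  u k t i j := by unfold ofSample; simp only; split_ifs <;> fun_prop
  s k t := by unfold ofSample; simp only; split_ifs <;> fun_prop
  ξ k t := by unfold ofSample; simp only; split_ifs <;> fun_prop
  r k := by unfold ofSample; simp only; split_ifs <;> fun_prop

end OfSample

/-! ### The joint law. -/

section Law

variable {d K T B₁ B₂ : ℕ} {𝒵 R : Type*} [MeasurableSpace 𝒵] [MeasurableSpace R]
  {𝒟 : Measure 𝒵} {ν : Measure R} {σ : ℕ → ℝ}

instance : IsProbabilityMeasure uniformUnitInterval :=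
  ⟨by simp [uniformUnitInterval]⟩

theorem ae_weight_mem_Icc :
    ∀ᵐ s ∂sampleLaw K T B₁ B₂ d 𝒟 σ ν, ∀ p, s.2.2.1 p ∈ Set.Icc (0 : ℝ) 1 := by
  have h1 : ∀ᵐ w ∂(Measure.pi fun _ : Round K T => uniformUnitInterval),
      ∀ p, w p ∈ Set.Icc (0 : ℝ) 1 :=
    ae_all_iff.2 fun _ =>
      Measure.tendsto_eval_ae_ae.eventually (ae_restrict_mem measurableSet_Icc)
  exact (((Measure.quasiMeasurePreserving_fst.comp Measure.quasiMeasurePreserving_snd).comp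
    Measure.quasiMeasurePreserving_snd).ae h1)

variable [NeZero d] [IsProbabilityMeasure 𝒟] [IsProbabilityMeasure ν]

instance : IsProbabilityMeasure (sampleLaw K T B₁ B₂ d 𝒟 σ ν) := by
  unfold sampleLaw; infer_instance

/-- Resampling the batch of one round. -/
theorem lintegral_sampleLaw_eq_replaceBatch (p : Round K T)
    {φ : SampleSpace K T B₁ B₂ d 𝒵 R → ENNReal} (hφ : Measurable φ) :
    ∫⁻ s, φ s ∂sampleLaw K T B₁ B₂ d 𝒟 σ ν =
      ∫⁻ s, ∫⁻ z, ∫⁻ u, φ (replaceBatch p s z u) ∂(Measure.pi fun _ => uniformSphere d)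
        ∂(Measure.pi fun _ => 𝒟) ∂sampleLaw K T B₁ B₂ d 𝒟 σ ν :=
  lintegral_prod_prod_mix (fun q : DataIndex K T B₁ B₂ => q.1 = p)
    (fun q : DataIndex K T B₁ B₂ × Fin d => q.1.1 = p) 𝒟 (uniformSphere d) _ hφ

end Law

/-! ### The oracle error along a run. -/

section Run

variable {d K T B₁ B₂ : ℕ} {𝒵 R : Type*} [MeasurableSpace R]
  {f : Vec d → 𝒵 → ℝ} {δ : ℝ} {A : OCOAlgorithm d R}

theorem oracleEstimate_one (x₁ : Vec d) (ρ : Randomness d 𝒵 R) (k : ℕ) :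
    oracleEstimate f δ T B₁ B₂ A x₁ ρ k 1 = gradEst f δ (queryPoint f δ T B₁ B₂ A x₁ ρ k 1)
      (fun i : Fin B₁ => ρ.z k 1 i) (fun i : Fin B₁ => ρ.u k 1 i) :=
  rfl

theorem oracleEstimate_add_two (x₁ : Vec d) (ρ : Randomness d 𝒵 R) (k n : ℕ) :
    oracleEstimate f δ T B₁ B₂ A x₁ ρ k (n + 2) = oracleEstimate f δ T B₁ B₂ A x₁ ρ k (n + 1) +
      diffEst f δ (queryPoint f δ T B₁ B₂ A x₁ ρ k (n + 2))
        (queryPoint f δ T B₁ B₂ A x₁ ρ k (n + 1))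
        (fun i : Fin B₂ => ρ.z k (n + 2) i) (fun i : Fin B₂ => ρ.u k (n + 2) i) :=
  rfl

/-- The displacement is `s'Δ' + (1 - s)Δ`: the rest of the previous step plus part of the new one.
Both weights lie in `[0,1]`. -/
theorem norm_queryPoint_sub_le {D : ℝ} (hA : A.DomainBounded D) (x₁ : Vec d)
    (ρ : Randomness d 𝒵 R) (k n : ℕ) (hs : ρ.s k (n + 1) ∈ Set.Icc (0 : ℝ) 1)
    (hs' : ρ.s k (n + 2) ∈ Set.Icc (0 : ℝ) 1) :
    ‖queryPoint f δ T B₁ B₂ A x₁ ρ k (n + 2) - queryPoint f δ T B₁ B₂ A x₁ ρ k (n + 1)‖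
      ≤ 2 * D := by
  set x₀ := epochStart f δ T B₁ B₂ A x₁ ρ (k - 1)
  set Δ := A.act n (ρ.r k) (epoch f δ B₁ B₂ A ρ k x₀ n).feedback
  set Δ' := A.act (n + 1) (ρ.r k) (epoch f δ B₁ B₂ A ρ k x₀ (n + 1)).feedback
  have h : queryPoint f δ T B₁ B₂ A x₁ ρ k (n + 2) - queryPoint f δ T B₁ B₂ A x₁ ρ k (n + 1) =
      ((epoch f δ B₁ B₂ A ρ k x₀ n).x + Δ + ρ.s k (n + 2) • Δ') -
        ((epoch f δ B₁ B₂ A ρ k x₀ n).x + ρ.s k (n + 1) • Δ) := rfl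
  have h' : queryPoint f δ T B₁ B₂ A x₁ ρ k (n + 2) - queryPoint f δ T B₁ B₂ A x₁ ρ k (n + 1) =
      ρ.s k (n + 2) • Δ' + (1 - ρ.s k (n + 1)) • Δ := by
    rw [h, sub_smul, one_smul]
    abel
  have hΔ : ‖Δ‖ ≤ D := hA _ _ _
  have hΔ' : ‖Δ'‖ ≤ D := hA _ _ _
  have hD : 0 ≤ D := (norm_nonneg _).trans hΔ
  rw [h']
  refine (norm_add_le _ _).trans ?_
  rw [norm_smul, norm_smul, Real.norm_of_nonneg hs'.1, Real.norm_of_nonneg (by linarith [hs.2])]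
  nlinarith [mul_le_mul hs'.2 hΔ' (norm_nonneg _) zero_le_one,
    mul_le_mul (by linarith [hs.1] : 1 - ρ.s k (n + 1) ≤ 1) hΔ (norm_nonneg _) zero_le_one]

section Replace

variable [Nonempty 𝒵] [Nonempty R] (p : Round K T) (s : SampleSpace K T B₁ B₂ d 𝒵 R)
  (z : DataIndex K T B₁ B₂ → 𝒵) (u : DataIndex K T B₁ B₂ × Fin d → Vec d) (x₁ : Vec d)

theorem epochStart_replaceBatch :
    epochStart f δ T B₁ B₂ A x₁ (ofSample (replaceBatch p s z u)) (p.1 - 1) =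
      epochStart f δ T B₁ B₂ A x₁ (ofSample s) (p.1 - 1) := by
  have hp := Finset.mem_Icc.1 p.1.2
  refine (agreeOn_replaceBatch p s z u).epochStart_eq x₁ (by omega) fun k hk t _ h => ?_
  have := Finset.mem_Icc.1 hk
  omega

theorem epoch_replaceBatch {n : ℕ} (hn : n < p.2) :
    epoch f δ B₁ B₂ A (ofSample (replaceBatch p s z u)) p.1
        (epochStart f δ T B₁ B₂ A x₁ (ofSample (replaceBatch p s z u)) (p.1 - 1)) n =
      epoch f δ B₁ B₂ A (ofSample s) p.1 (epochStart f δ T B₁ B₂ A x₁ (ofSample s) (p.1 - 1)) n := by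
  have hp := Finset.mem_Icc.1 p.2.2
  rw [epochStart_replaceBatch]
  refine (agreeOn_replaceBatch p s z u).epoch_eq p.1.2 _ (by omega) fun t ht h => ?_
  have := Finset.mem_Icc.1 ht
  omega

theorem queryPoint_replaceBatch {n : ℕ} (hn : n + 1 ≤ p.2) :
    queryPoint f δ T B₁ B₂ A x₁ (ofSample (replaceBatch p s z u)) p.1 (n + 1) =
      queryPoint f δ T B₁ B₂ A x₁ (ofSample s) p.1 (n + 1) := by
  have hp := Finset.mem_Icc.1 p.2.2
  rw [queryPoint, queryPoint, epochStart_replaceBatch]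
  refine (agreeOn_replaceBatch p s z u).epoch_w_eq p.1.2 _ (by omega) fun t ht h => ?_
  have := Finset.mem_Icc.1 ht
  omega

end Replace

variable [MeasurableSpace 𝒵]

theorem measurable_queryPoint {Ω : Type*} [MeasurableSpace Ω] {ρ : Ω → Randomness d 𝒵 R}
    (hf : Measurable (Function.uncurry f)) (hρ : MeasurableRandomness ρ) (x₁ : Vec d) (k t : ℕ) :
    Measurable fun ω => queryPoint f δ T B₁ B₂ A x₁ (ρ ω) k t :=
  (measurable_epoch hf B₁ B₂ A hρ k (measurable_epochStart hf T B₁ B₂ A hρ x₁ (k - 1)) t).2.1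

theorem measurable_oracleEstimate {Ω : Type*} [MeasurableSpace Ω] {ρ : Ω → Randomness d 𝒵 R}
    (hf : Measurable (Function.uncurry f)) (hρ : MeasurableRandomness ρ) (x₁ : Vec d) (k t : ℕ) :
    Measurable fun ω => oracleEstimate f δ T B₁ B₂ A x₁ (ρ ω) k t :=
  (measurable_epoch hf B₁ B₂ A hρ k (measurable_epochStart hf T B₁ B₂ A hρ x₁ (k - 1)) t).2.2.1

theorem measurable_gradient (F : Vec d → ℝ) : Measurable (gradient F) :=
  (InnerProductSpace.toDual ℝ (Vec d)).symm.continuous.measurable.comp (measurable_fderiv ℝ F)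

/-- The error of the oracle in round `(k, t)`. -/
def oracleError (𝒟 : Measure 𝒵) (f : Vec d → 𝒵 → ℝ) (δ : ℝ) (T B₁ B₂ : ℕ) (A : OCOAlgorithm d R)
    (x₁ : Vec d) (ρ : Randomness d 𝒵 R) (k t : ℕ) : Vec d :=
  oracleEstimate f δ T B₁ B₂ A x₁ ρ k t -
    gradient (smoothing δ (objective 𝒟 f)) (queryPoint f δ T B₁ B₂ A x₁ ρ k t)

theorem measurable_oracleError (𝒟 : Measure 𝒵) {Ω : Type*} [MeasurableSpace Ω]
    {ρ : Ω → Randomness d 𝒵 R} (hf : Measurable (Function.uncurry f))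
    (hρ : MeasurableRandomness ρ) (x₁ : Vec d) (k t : ℕ) :
    Measurable fun ω => oracleError 𝒟 f δ T B₁ B₂ A x₁ (ρ ω) k t :=
  (measurable_oracleEstimate hf hρ x₁ k t).sub
    ((measurable_gradient _).comp (measurable_queryPoint hf hρ x₁ k t))

theorem oracleError_replaceBatch [Nonempty 𝒵] [Nonempty R] (𝒟 : Measure 𝒵) (p : Round K T)
    (s : SampleSpace K T B₁ B₂ d 𝒵 R) (z : DataIndex K T B₁ B₂ → 𝒵)
    (u : DataIndex K T B₁ B₂ × Fin d → Vec d) (x₁ : Vec d) {n : ℕ} (hn : n < p.2) :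
    oracleError 𝒟 f δ T B₁ B₂ A x₁ (ofSample (replaceBatch p s z u)) p.1 n =
      oracleError 𝒟 f δ T B₁ B₂ A x₁ (ofSample s) p.1 n := by
  simp only [oracleError, oracleEstimate, queryPoint, epoch_replaceBatch p s z u x₁ hn]

end Run

/-! ### Recursion for the mean squared error. -/

section Bound

variable {d K T B₁ B₂ : ℕ} [NeZero d] {𝒵 R : Type*} [MeasurableSpace 𝒵] [MeasurableSpace R]
  [Nonempty 𝒵] [Nonempty R]
  {𝒟 : Measure 𝒵} [IsProbabilityMeasure 𝒟] {ν : Measure R} [IsProbabilityMeasure ν] {σ : ℕ → ℝ}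
  {f : Vec d → 𝒵 → ℝ} {L : NNReal} {δ : ℝ} {A : OCOAlgorithm d R}

theorem lintegral_oracleError_one_le (hB₁ : 1 ≤ B₁) (hδ : 0 < δ) (hf_meas : ∀ x, Measurable (f x))
    (hf_int : ∀ x, Integrable (f x) 𝒟) (hf_lip : ∀ z, LipschitzWith L fun x => f x z)
    (x₁ : Vec d) {k : ℕ} (hk : k ∈ Finset.Icc 1 K) (hT : 1 ≤ T) :
    ∫⁻ s, ENNReal.ofReal (‖oracleError 𝒟 f δ T B₁ B₂ A x₁ (ofSample s) k 1‖ ^ 2)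
      ∂sampleLaw K T B₁ B₂ d 𝒟 σ ν ≤ ENNReal.ofReal (2 * d * L ^ 2 / B₁) := by
  have hfm := measurable_uncurry_of_lipschitz hf_meas hf_lip
  set p : Round K T := (⟨k, hk⟩, ⟨1, by simpa using hT⟩)
  have hlt : ∀ i : Fin B₁, (i : ℕ) < batchSize B₁ B₂ p.2 := fun i => i.2
  rw [lintegral_sampleLaw_eq_replaceBatch p
    ((measurable_oracleError 𝒟 hfm measurableRandomness_ofSample x₁ k 1).norm.pow_const
      2).ennreal_ofReal]
  refine (lintegral_mono (g := fun _ => ENNReal.ofReal (2 * d * L ^ 2 / B₁)) fun s => ?_).trans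
    (by simp)
  have he : Function.Injective fun i : Fin B₁ => (⟨p, ⟨i, hlt i⟩⟩ : DataIndex K T B₁ B₂) :=
    fun i j h => by simpa [Fin.ext_iff] using h
  refine le_trans (le_of_eq (lintegral_congr fun z => lintegral_congr fun u => ?_))
    (lintegral_gradEst_le hδ hf_meas hf_int hf_lip hB₁ he
      (queryPoint f δ T B₁ B₂ A x₁ (ofSample s) k 1))
  rw [oracleError, oracleEstimate_one, queryPoint_replaceBatch p s z u x₁ (n := 0) le_rfl]
  congr 5
  · exact funext fun i => ofSample_replaceBatch_z p s z u (hlt i)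
  · exact funext fun i => ofSample_replaceBatch_u p s z u (hlt i)

/-- With the batch of round `n + 2` resampled, the previous error is a constant shift and the new
increment is centered, so only the variance of the increment is added. -/
theorem lintegral_oracleError_add_two_le (hB₂ : 1 ≤ B₂) (hδ : 0 < δ)
    (hf_meas : ∀ x, Measurable (f x))
    (hf_int : ∀ x, Integrable (f x) 𝒟) (hf_lip : ∀ z, LipschitzWith L fun x => f x z)
    {D : ℝ} (hA : A.DomainBounded D) (x₁ : Vec d) {k n : ℕ} (hk : k ∈ Finset.Icc 1 K)
    (hn : n + 2 ≤ T) :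
    ∫⁻ s, ENNReal.ofReal (‖oracleError 𝒟 f δ T B₁ B₂ A x₁ (ofSample s) k (n + 2)‖ ^ 2)
      ∂sampleLaw K T B₁ B₂ d 𝒟 σ ν ≤
    ∫⁻ s, ENNReal.ofReal (‖oracleError 𝒟 f δ T B₁ B₂ A x₁ (ofSample s) k (n + 1)‖ ^ 2)
      ∂sampleLaw K T B₁ B₂ d 𝒟 σ ν + ENNReal.ofReal (2 * d * (L * (2 * D) / δ) ^ 2 / B₂) := by
  have hfm := measurable_uncurry_of_lipschitz hf_meas hf_lip
  have hmem : n + 2 ∈ Finset.Icc 1 T := by simpa using hn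
  have hmem' : n + 1 ∈ Finset.Icc 1 T := by simp only [Finset.mem_Icc]; omega
  set p : Round K T := (⟨k, hk⟩, ⟨n + 2, hmem⟩)
  have hlt : ∀ i : Fin B₂, (i : ℕ) < batchSize B₁ B₂ p.2 := fun i => i.2
  have he : Function.Injective fun i : Fin B₂ => (⟨p, ⟨i, hlt i⟩⟩ : DataIndex K T B₁ B₂) :=
    fun i j h => by simpa [Fin.ext_iff] using h
  rw [lintegral_sampleLaw_eq_replaceBatch p
    ((measurable_oracleError 𝒟 hfm measurableRandomness_ofSample x₁ k (n + 2)).norm.pow_const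
      2).ennreal_ofReal]
  have hconst : ∫⁻ _, ENNReal.ofReal (2 * d * (L * (2 * D) / δ) ^ 2 / B₂)
      ∂sampleLaw K T B₁ B₂ d 𝒟 σ ν = ENNReal.ofReal (2 * d * (L * (2 * D) / δ) ^ 2 / B₂) := by
    simp
  rw [← hconst, ← lintegral_add_right _ measurable_const]
  refine lintegral_mono_ae ?_
  -- The bound on the displacement requires weights in `[0,1]`, which holds only almost surely.
  filter_upwards [ae_weight_mem_Icc] with s hs
  have hw := norm_queryPoint_sub_le (f := f) (δ := δ) (T := T) (B₁ := B₁) (B₂ := B₂) hA x₁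
    (ofSample s) k n (by rw [ofSample_s s hk hmem']; exact hs _)
    (by rw [ofSample_s s hk hmem]; exact hs _)
  rw [← ENNReal.ofReal_add (sq_nonneg _) (by positivity)]
  refine le_trans (le_of_eq (lintegral_congr fun z => lintegral_congr fun u => ?_))
    ((lintegral_diffEst_le hδ hf_meas hf_int hf_lip hB₂ he
      (oracleError 𝒟 f δ T B₁ B₂ A x₁ (ofSample s) k (n + 1))
      (queryPoint f δ T B₁ B₂ A x₁ (ofSample s) k (n + 2))
      (queryPoint f δ T B₁ B₂ A x₁ (ofSample s) k (n + 1))).trans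
      (ENNReal.ofReal_le_ofReal (by gcongr)))
  -- The previous error and both query points do not see the replaced batch; written on the replaced
  -- sample, they match the one-step recursion for `g`.
  rw [← oracleError_replaceBatch 𝒟 p s z u x₁ (by exact Nat.lt_succ_self _ : n + 1 < p.2)]
  rw [← queryPoint_replaceBatch p s z u x₁ (n := n + 1) le_rfl,
    ← queryPoint_replaceBatch p s z u x₁ (n := n) (by exact Nat.le_succ _)]
  have hz : (fun i : Fin B₂ => (ofSample (replaceBatch p s z u)).z p.1 p.2 i) =
      fun i : Fin B₂ => z ⟨p, ⟨i, hlt i⟩⟩ :=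
    funext fun i => ofSample_replaceBatch_z p s z u (hlt i)
  have hu : (fun i : Fin B₂ => (ofSample (replaceBatch p s z u)).u p.1 p.2 i) =
      fun (i : Fin B₂) j => u (⟨p, ⟨i, hlt i⟩⟩, j) :=
    funext fun i => ofSample_replaceBatch_u p s z u (hlt i)
  rw [← hz, ← hu]
  rw [oracleError, oracleEstimate_add_two, oracleError]
  congr 3
  abel

theorem lintegral_oracleError_le (hB₁ : 1 ≤ B₁) (hB₂ : 1 ≤ B₂) (hδ : 0 < δ)
    (hf_meas : ∀ x, Measurable (f x))
    (hf_int : ∀ x, Integrable (f x) 𝒟) (hf_lip : ∀ z, LipschitzWith L fun x => f x z)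
    {D : ℝ} (hA : A.DomainBounded D) (x₁ : Vec d) {k n : ℕ} (hk : k ∈ Finset.Icc 1 K)
    (hn : n + 1 ≤ T) :
    ∫⁻ s, ENNReal.ofReal (‖oracleError 𝒟 f δ T B₁ B₂ A x₁ (ofSample s) k (n + 1)‖ ^ 2)
      ∂sampleLaw K T B₁ B₂ d 𝒟 σ ν ≤
    ENNReal.ofReal (2 * d * L ^ 2 / B₁ + n * (2 * d * (L * (2 * D) / δ) ^ 2 / B₂)) := by
  induction n with
  | zero =>
    simpa using lintegral_oracleError_one_le hB₁ hδ hf_meas hf_int hf_lip x₁ hk hn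
  | succ n ih =>
    refine (lintegral_oracleError_add_two_le hB₂ hδ hf_meas hf_int hf_lip hA x₁ hk hn).trans ?_
    refine (add_le_add_left (ih (by omega)) _).trans ?_
    rw [← ENNReal.ofReal_add (by positivity) (by positivity)]
    refine ENNReal.ofReal_le_ofReal (le_of_eq ?_)
    push_cast
    ring

end Bound

end O2NC

end

/-! ### Transfer to an arbitrary probability space and the final constants. -/

theorem mainTheorem4 {d K T B₁ B₂ : ℕ} (hd : 1 ≤ d) (hB₁ : 1 ≤ B₁) (hB₂ : 1 ≤ B₂)
    {𝒵 : Type*} [MeasurableSpace 𝒵] (𝒟 : Measure 𝒵) [IsProbabilityMeasure 𝒟]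
    (f : O2NC.Vec d → 𝒵 → ℝ) (L : NNReal) {δ : ℝ} (hδ : 0 < δ)
    (hf_meas : ∀ x, Measurable (f x))
    (hf_int : ∀ x, Integrable (f x) 𝒟)
    (hf_diff : ∀ z, Differentiable ℝ (fun x => f x z))
    (hf_lip : ∀ z, LipschitzWith L (fun x => f x z))
    {R : Type*} [MeasurableSpace R] (ν : Measure R) [IsProbabilityMeasure ν]
    (A : O2NC.OCOAlgorithm d R) (hA : A.DomainBounded (δ / T))
    (x₁ : O2NC.Vec d) (σ : ℕ → ℝ)
    {Ω : Type*} [MeasurableSpace Ω] (P : Measure Ω) [IsProbabilityMeasure P]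
    (ρ : Ω → O2NC.Randomness d 𝒵 R)
    (hρ : HasLaw (fun ω => (ρ ω).used K T B₁ B₂) (O2NC.sampleLaw K T B₁ B₂ d 𝒟 σ ν) P) :
    Differentiable ℝ (O2NC.smoothing δ (O2NC.objective 𝒟 f)) ∧
    ∀ k ∈ Finset.Icc 1 K, ∀ t ∈ Finset.Icc 1 T,
      Integrable (fun ω =>
        ‖gradient (O2NC.smoothing δ (O2NC.objective 𝒟 f))
            (O2NC.queryPoint f δ T B₁ B₂ A x₁ (ρ ω) k t)
          - O2NC.oracleEstimate f δ T B₁ B₂ A x₁ (ρ ω) k t‖ ^ 2) P ∧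
      ∫ ω, ‖gradient (O2NC.smoothing δ (O2NC.objective 𝒟 f))
            (O2NC.queryPoint f δ T B₁ B₂ A x₁ (ρ ω) k t)
          - O2NC.oracleEstimate f δ T B₁ B₂ A x₁ (ρ ω) k t‖ ^ 2 ∂P
        ≤ 16 * d * (L : ℝ) ^ 2 / B₁ + 64 * d * (L : ℝ) ^ 2 / (B₂ * T) := by
  have : NeZero d := ⟨by omega⟩
  have : Nonempty 𝒵 := 𝒟.nonempty_of_neZero
  have : Nonempty R := ν.nonempty_of_neZero
  have hF := O2NC.lipschitzWith_objective hf_int hf_lip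
  refine ⟨O2NC.differentiable_smoothing hF hδ.ne', fun k hk t ht => ?_⟩
  obtain ⟨n, rfl⟩ : ∃ n, t = n + 1 := ⟨t - 1, by have := Finset.mem_Icc.1 ht; omega⟩
  have hn : n + 1 ≤ T := (Finset.mem_Icc.1 ht).2
  have hfm := O2NC.measurable_uncurry_of_lipschitz hf_meas hf_lip
  set ψ : O2NC.SampleSpace K T B₁ B₂ d 𝒵 R → ℝ := fun s =>
    ‖O2NC.oracleError 𝒟 f δ T B₁ B₂ A x₁ (O2NC.ofSample s) k (n + 1)‖ ^ 2 with hψ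
  have hψm : Measurable ψ := (O2NC.measurable_oracleError 𝒟 hfm
    O2NC.measurableRandomness_ofSample x₁ k (n + 1)).norm.pow_const 2
  have hψ0 : ∀ s, 0 ≤ ψ s := fun s => sq_nonneg _
  -- The error depends on `ω` only through the used sample, so its law is determined by `hρ`.
  have hkey : ∀ ω, ‖gradient (O2NC.smoothing δ (O2NC.objective 𝒟 f))
            (O2NC.queryPoint f δ T B₁ B₂ A x₁ (ρ ω) k (n + 1))
          - O2NC.oracleEstimate f δ T B₁ B₂ A x₁ (ρ ω) k (n + 1)‖ ^ 2 =
      ψ ((ρ ω).used K T B₁ B₂) := by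
    intro ω
    have hag := O2NC.agreeOn_ofSample_used (K := K) (T := T) (B₁ := B₁) (B₂ := B₂) (ρ ω)
    have hkK := Finset.mem_Icc.1 hk
    rw [norm_sub_rev]
    simp only [hψ, O2NC.oracleError, O2NC.oracleEstimate, O2NC.queryPoint,
      hag.epochStart_eq x₁ (by omega : k - 1 ≤ K) fun _ _ _ _ => trivial,
      hag.epoch_eq hk _ hn fun _ _ => trivial]
  have hbound := O2NC.lintegral_oracleError_le (K := K) (σ := σ) (ν := ν) hB₁ hB₂ hδ hf_meas
    hf_int hf_lip hA x₁ hk hn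
  have hψi : Integrable ψ (O2NC.sampleLaw K T B₁ B₂ d 𝒟 σ ν) := by
    refine ⟨hψm.aestronglyMeasurable, ?_⟩
    rw [hasFiniteIntegral_iff_ofReal (.of_forall hψ0)]
    exact hbound.trans_lt ENNReal.ofReal_lt_top
  simp_rw [hkey]
  rw [← hρ.map_eq] at hψi
  refine ⟨hψi.comp_aemeasurable hρ.aemeasurable, ?_⟩
  rw [← integral_map hρ.aemeasurable hψi.aestronglyMeasurable, hρ.map_eq,
    integral_eq_lintegral_of_nonneg_ae (.of_forall hψ0) hψm.aestronglyMeasurable]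
  refine (ENNReal.toReal_le_of_le_ofReal (by positivity) hbound).trans ?_
  have hT : (0 : ℝ) < T := by exact_mod_cast (by omega : 0 < T)
  have hB₁' : (0 : ℝ) < B₁ := by exact_mod_cast hB₁
  have hB₂' : (0 : ℝ) < B₂ := by exact_mod_cast hB₂
  have hnT : (n : ℝ) ≤ T := by exact_mod_cast (by omega : n ≤ T)
  refine add_le_add ?_ ?_
  · gcongr
    norm_num
  -- With `D = δ / T` the radius `δ` cancels and each increment costs `8dL²/(B₂T²)`. There are `n =
  -- t - 1 ≤ T` of them, so the argument gives constants `2` and `8`, below the claimed `16` and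
  -- `64`.
  · calc (n : ℝ) * (2 * d * (L * (2 * (δ / T)) / δ) ^ 2 / B₂)
        ≤ T * (2 * d * (L * (2 * (δ / T)) / δ) ^ 2 / B₂) := by gcongr
      _ = 8 * d * (L : ℝ) ^ 2 / (B₂ * T) := by field_simp; ring
      _ ≤ 64 * d * (L : ℝ) ^ 2 / (B₂ * T) := by gcongr; norm_num
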